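/- **Setting.** First-order temporal logic over time $\mathbb N$ (language: constants and predicate symbols; no equality, no function symbols). A temporal structure has a fixed non-empty domain, a rigid interpretation of constants, and a flexible interpretation of predicates. A *monodic temporal problem* $\mathsf P=\langle\mathcal U,\mathcal I,\mathcal S,\mathcal E\rangle$ consists of finite sets $\mathcal U$ (universal part) and $\mathcal I$ (initial part) of closed first-order formulae, a finite set $\mathcal S$ of step clauses $l\Rightarrow\bigcirc m$ (ground; $l,m$ propositional literals) and $L(x)\Rightarrow\bigcirc M(x)$ (non-ground; $L,M$ unary literals), with no two different step clauses having the same left-hand side, and a finite set $\mathcal E$ of eventualities $\Diamond l$ and $\Diamond L(x)$. It is satisfiable if the formula $\mathcal I\wedge\Box\,\mathcal U\wedge\Box\forall x\,\mathcal S\wedge\Box\forall x\,\mathcal E$ is. Its *constant flooded form* $\mathsf P^c$ is obtained by adding $\Diamond L(c)$ for all $\Diamond L(x)\in\mathcal E$ and all constants $c$ of $\mathsf P$, with $L(c)$ renamed by a fresh proposition $l$ (that is, $\Diamond l$ is added to $\mathcal E$ and $l\Rightarrow L(c)$ to $\mathcal U$). **Merged clauses.** For a non-empty set $\{L_i(x)\Rightarrow\bigcirc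 M_i(x)\}_{i\le k}$ of non-ground step clauses in $\mathcal S$, the clauses $\forall x\bigvee_i L_i(x)\Rightarrow\bigcirc\forall x\bigvee_i M_i(x)$, $\ \exists x\bigwedge_i L_i(x)\Rightarrow\bigcirc\exists x\bigwedge_i M_i(x)$ and $L_i(c)\Rightarrow\bigcirc M_i(c)$ ($c$ a constant of $\mathsf P$) are *derived step clauses*. A *merged derived step clause* $\mathcal A\Rightarrow\bigcirc\mathcal B$ is the conjunction of the left-hand sides implying the conjunction of the right-hand sides (under $\bigcirc$) of a finite, possibly empty, set of derived step clauses and ground step clauses of $\mathcal S$. A *full merged step clause* is $\forall x(\mathcal A\wedge A(x)\Rightarrow\bigcirc(\mathcal B\wedge B(x)))$, where $A(x)$, $B(x)$ are the conjunctions of the left-, respectively right-hand sides of a possibly empty set of non-ground step clauses of $\mathcal S$. A *loop* in $\Diamond L(x)\in\mathcal E$ is a non-empty finite set of full merged step clauses, with left-hand sides $\mathcal A_i\wedge A_i(x)$ and right-hand sides $\mathcal B_i\wedge B_i(x)$, such that for all $i$ both $\forall x(\mathcal U\wedge\mathcal B_i\wedge B_i(x)\Rightarrow\neg L(x))$ and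 $\forall x(\mathcal U\wedge\mathcal B_i\wedge B_i(x)\Rightarrow\bigvee_j(\mathcal A_j\wedge A_j(x)))$ are valid; $\bigvee_j(\mathcal A_j\wedge A_j(x))$ is its *loop formula*. Loops in a ground eventuality $\Diamond l$ are defined in the same way with merged derived step clauses only. **Temporal resolution.** A derivation is a sequence $\mathcal U=\mathcal U_0\subseteq\mathcal U_1\subseteq\dots\subseteq\mathcal U_n$ of universal parts, each extending the previous one by the conclusion of a rule with respect to the current universal part (written $\mathcal U$ again): *step resolution* ($\neg\mathcal A$ is added if $\mathcal A\Rightarrow\bigcirc\mathcal B$ is a merged derived step clause and $\mathcal U\cup\{\mathcal B\}\models\bot$); *eventuality resolution* ($\forall x\bigwedge_i(\neg\mathcal A_i\vee\neg A_i(x))$ is added for a loop in $\Diamond L(x)\in\mathcal E$); *ground eventuality resolution* ($\bigwedge_i\neg\mathcal A_i$ is added for a loop in $\Diamond l\in\mathcal E$). It terminates successfully if $\mathcal U_n\cup\mathcal I\models\bot$, or $\mathcal U_n\models\forall x\neg L(x)$ for some $\Diamond L(x)\in\mathcal E$, or $\mathcal U_n\models\neg l$ for some $\Diamond l\in\mathcal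 E$. **Breadth-first loop search** for $\Diamond L(x)\in\mathcal E$. Let $H_0=\mathbf{true}$. For $i=0,1,2,\dots$ let $N_{i+1}$ be the set of all full merged step clauses whose right-hand side $\mathcal B\wedge B(x)$ makes $\forall x(\mathcal U\wedge\mathcal B\wedge B(x)\Rightarrow\neg L(x)\wedge H_i(x))$ valid. If $N_{i+1}=\emptyset$, return $\mathbf{false}$. Otherwise let $H_{i+1}(x)$ be the disjunction of the left-hand sides of the clauses in $N_{i+1}$; if $\forall x(H_i(x)\Rightarrow H_{i+1}(x))$ is valid, return $H_{i+1}(x)$ (and $N_{i+1}$ is *the loop found by the search*). For a ground eventuality, merged derived step clauses are used instead. **Theorem (Relative Completeness).** Let $\mathsf P$ be a monodic temporal problem. 1. For every eventuality in $\mathcal E$ the breadth-first loop search terminates. Either its last set of clauses is empty and it returns $\mathbf{false}$, or its last set of clauses is a loop in the eventuality and it returns the loop formula of that loop. In both cases $\forall x(\mathbf L(x)\Rightarrow H(x))$ is valid for the returned formula $H(x)$ and the loop formula $\mathbf L(x)$ of every loop in the same eventuality. 2. If $\mathsf P$ is unsatisfiable, then there is a successfully terminating derivation by temporal resolution from $\mathsf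 P^c$ in which the eventuality resolution rule and the ground eventuality resolution rule are applied only to loops found by the breadth-first loop search, run on the problem with the current universal part. -/

import Mathlib

namespace FOTL

/-! ### First-order formulae (no equality, no function symbols of positive arity) -/

/-- A first-order language: individual constants, and predicate symbols of each arity.
The elements of `Pred 0` are the propositions. -/
structure Signature where
  Const : Type
  Pred : ℕ → Type

/-- Terms: individual variables `x_0, x_1, …` and individual constants. -/
inductive Tm (C : Type) : Type
  | var (i : ℕ) : Tm C
  | const (c : C) : Tm C

/-- Classical first-order formulae. -/
inductive Formula (σ : Signature) : Type
  | tru : Formula σ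
  | fal : Formula σ
  | atom {n : ℕ} (p : σ.Pred n) (ts : Fin n → Tm σ.Const) : Formula σ
  | neg (φ : Formula σ) : Formula σ
  | and (φ ψ : Formula σ) : Formula σ
  | or (φ ψ : Formula σ) : Formula σ
  | imp (φ ψ : Formula σ) : Formula σ
  | all (i : ℕ) (φ : Formula σ) : Formula σ
  | ex (i : ℕ) (φ : Formula σ) : Formula σ

/-- A classical first-order structure with a non-empty domain. -/
structure Structure (σ : Signature) where
  D : Type
  nonempty : Nonempty D
  const : σ.Const → D
  pred : ∀ {n : ℕ}, σ.Pred n → (Fin n → D) → Prop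

/-- The variables of a term. -/
def Tm.vars {C : Type} : Tm C → Finset ℕ
  | .var i => {i}
  | .const _ => ∅

/-- The constants of a term. -/
def Tm.consts {C : Type} : Tm C → Finset C
  | .var _ => ∅
  | .const c => {c}

/-- The value of a term. -/
def Tm.eval {C D : Type} (I : C → D) (a : ℕ → D) : Tm C → D
  | .var i => a i
  | .const c => I c

namespace Formula

variable {σ : Signature}

/-- The free variables of a formula. -/
def freeVars : Formula σ → Finset ℕ
  | tru => ∅
  | fal => ∅
  | atom _ ts => Finset.univ.biUnion fun k => (ts k).vars
  | neg φ => φ.freeVars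
  | and φ ψ => φ.freeVars ∪ ψ.freeVars
  | or φ ψ => φ.freeVars ∪ ψ.freeVars
  | imp φ ψ => φ.freeVars ∪ ψ.freeVars
  | all i φ => φ.freeVars.erase i
  | ex i φ => φ.freeVars.erase i

/-- Closed formulae. -/
def Closed (φ : Formula σ) : Prop := φ.freeVars = ∅

open Classical in
/-- The constants occurring in a formula. -/
noncomputable def consts : Formula σ → Finset σ.Const
  | tru => ∅
  | fal => ∅
  | atom _ ts => Finset.univ.biUnion fun k => (ts k).consts
  | neg φ => φ.consts
  | and φ ψ => φ.consts ∪ ψ.consts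
  | or φ ψ => φ.consts ∪ ψ.consts
  | imp φ ψ => φ.consts ∪ ψ.consts
  | all _ φ => φ.consts
  | ex _ φ => φ.consts

/-- Truth of a formula in a structure under an assignment. -/
def Truth (M : Structure σ) : (ℕ → M.D) → Formula σ → Prop
  | _, tru => True
  | _, fal => False
  | a, atom p ts => M.pred p fun k => (ts k).eval M.const a
  | a, neg φ => ¬ Truth M a φ
  | a, and φ ψ => Truth M a φ ∧ Truth M a ψ
  | a, or φ ψ => Truth M a φ ∨ Truth M a ψ
  | a, imp φ ψ => Truth M a φ → Truth M a ψ
  | a, all i φ => ∀ d : M.D, Truth M (Function.update a i d) φ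
  | a, ex i φ => ∃ d : M.D, Truth M (Function.update a i d) φ

/-- A formula is valid if it is true in every structure under every assignment. -/
def Valid (φ : Formula σ) : Prop := ∀ (M : Structure σ) (a : ℕ → M.D), Truth M a φ

/-- `Γ ⊨ φ`. -/
def Entails (Γ : Finset (Formula σ)) (φ : Formula σ) : Prop :=
  ∀ (M : Structure σ) (a : ℕ → M.D), (∀ ψ ∈ Γ, Truth M a ψ) → Truth M a φ

/-- Conjunction of a list of formulae; the empty conjunction is `true`. -/
def conj (l : List (Formula σ)) : Formula σ := l.foldr and tru

/-- Disjunction of a list of formulae; the empty disjunction is `false`. -/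
def disj (l : List (Formula σ)) : Formula σ := l.foldr or fal

/-- The conjunction of the formulae `f i`, `i ∈ s`. -/
noncomputable def bigConj {ι : Type} (s : Finset ι) (f : ι → Formula σ) : Formula σ :=
  conj (s.toList.map f)

/-- The disjunction of the formulae `f i`, `i ∈ s`. -/
noncomputable def bigDisj {ι : Type} (s : Finset ι) (f : ι → Formula σ) : Formula σ :=
  disj (s.toList.map f)

end Formula

/-! ### Temporal formulae -/

/-- First-order temporal formulae, built from first-order formulae by Boolean operators,
quantifiers and `○` (next), `□` (always), `◊` (sometime). -/
inductive TFormula (σ : Signature) : Type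
  | fo (φ : Formula σ) : TFormula σ
  | neg (φ : TFormula σ) : TFormula σ
  | and (φ ψ : TFormula σ) : TFormula σ
  | or (φ ψ : TFormula σ) : TFormula σ
  | imp (φ ψ : TFormula σ) : TFormula σ
  | all (i : ℕ) (φ : TFormula σ) : TFormula σ
  | ex (i : ℕ) (φ : TFormula σ) : TFormula σ
  | next (φ : TFormula σ) : TFormula σ
  | always (φ : TFormula σ) : TFormula σ
  | sometime (φ : TFormula σ) : TFormula σ

/-- A first-order temporal structure: one non-empty domain, a rigid interpretation of the
constants, and at every moment of time an interpretation of the predicate symbols. -/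
structure TStructure (σ : Signature) where
  D : Type
  nonempty : Nonempty D
  const : σ.Const → D
  pred : ℕ → ∀ {n : ℕ}, σ.Pred n → (Fin n → D) → Prop

/-- The first-order structure at moment `t`. -/
def TStructure.world {σ : Signature} (M : TStructure σ) (t : ℕ) : Structure σ where
  D := M.D
  nonempty := M.nonempty
  const := M.const
  pred := fun p v => M.pred t p v

namespace TFormula

variable {σ : Signature}

/-- Truth of a temporal formula at a moment of time under an assignment. -/
def Truth (M : TStructure σ) : ℕ → (ℕ → M.D) → TFormula σ → Prop
  | t, a, fo φ => Formula.Truth (M.world t) a φ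
  | t, a, neg φ => ¬ Truth M t a φ
  | t, a, and φ ψ => Truth M t a φ ∧ Truth M t a ψ
  | t, a, or φ ψ => Truth M t a φ ∨ Truth M t a ψ
  | t, a, imp φ ψ => Truth M t a φ → Truth M t a ψ
  | t, a, all i φ => ∀ d : M.D, Truth M t (Function.update a i d) φ
  | t, a, ex i φ => ∃ d : M.D, Truth M t (Function.update a i d) φ
  | t, a, next φ => Truth M (t + 1) a φ
  | t, a, always φ => ∀ u, t ≤ u → Truth M u a φ
  | t, a, sometime φ => ∃ u, t ≤ u ∧ Truth M u a φ

/-- A formula is satisfiable if it is true at moment `0` of some temporal structure under some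
assignment. -/
def Satisfiable (φ : TFormula σ) : Prop := ∃ (M : TStructure σ) (a : ℕ → M.D), Truth M 0 a φ

/-- Conjunction of a list of temporal formulae. -/
def conj (l : List (TFormula σ)) : TFormula σ := l.foldr and (fo .tru)

end TFormula

/-! ### Temporal problems -/

/-- Literals over the predicate symbols of arity `n`: propositional literals for `n = 0`, unary
literals for `n = 1`. -/
structure Lit (σ : Signature) (n : ℕ) where
  positive : Bool
  sym : σ.Pred n

/-- The literal applied to `t`, that is `l` for `n = 0` and `L(t)` for `n = 1`. -/
def Lit.at {σ : Signature} {n : ℕ} (L : Lit σ n) (t : Tm σ.Const) : Formula σ :=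
  match L.positive with
  | true => .atom L.sym fun _ => t
  | false => .neg (.atom L.sym fun _ => t)

/-- The variable `x` of the clauses. -/
def x {C : Type} : Tm C := .var 0

/-- An original step clause: `l ⇒ ○m` (ground) for `n = 0`, and `L(x) ⇒ ○M(x)` (non-ground) for
`n = 1`. -/
structure StepClause (σ : Signature) (n : ℕ) where
  lhs : Lit σ n
  rhs : Lit σ n

/-- The temporal formula of a step clause. -/
def StepClause.formula {σ : Signature} {n : ℕ} (s : StepClause σ n) : TFormula σ :=
  .imp (.fo (s.lhs.at x)) (.next (.fo (s.rhs.at x)))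

/-- Eventualities `◊l` and `◊L(x)`. -/
inductive Eventuality (σ : Signature) : Type
  | ground (l : Lit σ 0) : Eventuality σ
  | nonGround (L : Lit σ 1) : Eventuality σ

/-- The first-order formula `l` or `L(x)` of an eventuality. -/
def Eventuality.lit {σ : Signature} : Eventuality σ → Formula σ
  | .ground l => l.at x
  | .nonGround L => L.at x

/-- The data of a temporal problem: universal, initial, step and eventuality part. -/
structure Problem (σ : Signature) where
  univ : Finset (Formula σ)
  init : Finset (Formula σ)
  groundSteps : Finset (StepClause σ 0)
  steps : Finset (StepClause σ 1)
  groundEvs : Finset (Lit σ 0)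
  evs : Finset (Lit σ 1)

namespace Problem

variable {σ : Signature}

/-- Monodic temporal problems in Divided Separated Normal Form: the universal and the initial part
consist of closed formulae, and different step clauses have different left-hand sides. -/
structure IsDSNF (P : Problem σ) : Prop where
  univ_closed : ∀ φ ∈ P.univ, φ.Closed
  init_closed : ∀ φ ∈ P.init, φ.Closed
  groundSteps_lhs : ∀ s ∈ P.groundSteps, ∀ s' ∈ P.groundSteps, s.lhs = s'.lhs → s = s'
  steps_lhs : ∀ s ∈ P.steps, ∀ s' ∈ P.steps, s.lhs = s'.lhs → s = s'

open Classical in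
/-- All eventualities of a problem. -/
noncomputable def eventualities (P : Problem σ) : Finset (Eventuality σ) :=
  P.groundEvs.image .ground ∪ P.evs.image .nonGround

/-- The universal part as one formula. -/
noncomputable def univConj (P : Problem σ) : Formula σ := Formula.bigConj P.univ id

/-- The formula `I ∧ □U ∧ □∀x S ∧ □∀x E` associated with a problem. -/
noncomputable def formula (P : Problem σ) : TFormula σ :=
  .and (.fo (Formula.bigConj P.init id)) <|
  .and (.always (.fo P.univConj)) <|
  .and (.always (.all 0 (TFormula.conj
    (P.groundSteps.toList.map StepClause.formula ++ P.steps.toList.map StepClause.formula)))) <|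
  .always (.all 0 (TFormula.conj (P.eventualities.toList.map fun e => .sometime (.fo e.lit))))

/-- A problem is satisfiable if its associated formula is. -/
def Satisfiable (P : Problem σ) : Prop := P.formula.Satisfiable

open Classical in
/-- The constants occurring in a problem (step clauses and eventualities contain none). -/
noncomputable def consts (P : Problem σ) : Finset σ.Const :=
  (P.univ ∪ P.init).biUnion Formula.consts

end Problem

/-! ### Merged step clauses -/

/-- The clauses that may be merged: the original ground step clauses and the derived step clauses
`∀x(L₁(x) ∨ … ∨ Lₖ(x)) ⇒ ○∀x(M₁(x) ∨ … ∨ Mₖ(x))`,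
`∃x(L₁(x) ∧ … ∧ Lₖ(x)) ⇒ ○∃x(M₁(x) ∧ … ∧ Mₖ(x))` and `L(c) ⇒ ○M(c)`. -/
inductive Mergeable (σ : Signature) : Type
  | ground (s : StepClause σ 0) : Mergeable σ
  | forallDisj (s : Finset (StepClause σ 1)) : Mergeable σ
  | existsConj (s : Finset (StepClause σ 1)) : Mergeable σ
  | inst (s : StepClause σ 1) (c : σ.Const) : Mergeable σ

namespace Mergeable

variable {σ : Signature}

/-- Left-hand side. -/
noncomputable def lhs : Mergeable σ → Formula σ
  | ground s => s.lhs.at x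
  | forallDisj s => .all 0 (Formula.bigDisj s fun t => t.lhs.at x)
  | existsConj s => .ex 0 (Formula.bigConj s fun t => t.lhs.at x)
  | inst s c => s.lhs.at (.const c)

/-- Right-hand side (under `○`). -/
noncomputable def rhs : Mergeable σ → Formula σ
  | ground s => s.rhs.at x
  | forallDisj s => .all 0 (Formula.bigDisj s fun t => t.rhs.at x)
  | existsConj s => .ex 0 (Formula.bigConj s fun t => t.rhs.at x)
  | inst s c => s.rhs.at (.const c)

end Mergeable

/-- A merged derived step clause `⋀ Φᵢ ⇒ ○⋀ Ψᵢ`, given by the set of the clauses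
`Φᵢ ⇒ ○Ψᵢ` that are merged. The empty set gives the degenerate clause `true ⇒ ○true`. -/
abbrev MergedDerived (σ : Signature) : Type := Finset (Mergeable σ)

/-- The left-hand side `𝒜` of a merged derived step clause. -/
noncomputable def MergedDerived.lhs {σ : Signature} (C : MergedDerived σ) : Formula σ :=
  Formula.bigConj C Mergeable.lhs

/-- The right-hand side `ℬ` of a merged derived step clause. -/
noncomputable def MergedDerived.rhs {σ : Signature} (C : MergedDerived σ) : Formula σ :=
  Formula.bigConj C Mergeable.rhs

/-- A full merged step clause `∀x(𝒜 ∧ A(x) ⇒ ○(ℬ ∧ B(x)))`, given by a merged derived step clause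
`𝒜 ⇒ ○ℬ` and a (possibly empty) set of original non-ground step clauses, where `A(x)` and `B(x)`
are the conjunctions of the left-hand and of the right-hand sides of the latter. -/
structure FullMerged (σ : Signature) where
  merged : MergedDerived σ
  side : Finset (StepClause σ 1)

namespace FullMerged

variable {σ : Signature}

/-- `A(x)`. -/
noncomputable def sideLhs (C : FullMerged σ) : Formula σ :=
  Formula.bigConj C.side fun s => s.lhs.at x

/-- `B(x)`. -/
noncomputable def sideRhs (C : FullMerged σ) : Formula σ :=
  Formula.bigConj C.side fun s => s.rhs.at x

/-- `𝒜 ∧ A(x)`. -/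
noncomputable def lhs (C : FullMerged σ) : Formula σ := .and C.merged.lhs C.sideLhs

/-- `ℬ ∧ B(x)`. -/
noncomputable def rhs (C : FullMerged σ) : Formula σ := .and C.merged.rhs C.sideRhs

end FullMerged

namespace Problem

variable {σ : Signature}

open Classical in
/-- The original ground step clauses and the derived step clauses of a problem. -/
noncomputable def mergeables (P : Problem σ) : Finset (Mergeable σ) :=
  P.groundSteps.image .ground ∪
  (P.steps.powerset.erase ∅).image .forallDisj ∪
  (P.steps.powerset.erase ∅).image .existsConj ∪
  (P.steps ×ˢ P.consts).image fun sc => .inst sc.1 sc.2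

/-- The merged derived step clauses of a problem. -/
noncomputable def mergedDerived (P : Problem σ) : Finset (MergedDerived σ) := P.mergeables.powerset

open Classical in
/-- The full merged step clauses of a problem. -/
noncomputable def fullMerged (P : Problem σ) : Finset (FullMerged σ) :=
  (P.mergedDerived ×ˢ P.steps.powerset).image fun c => ⟨c.1, c.2⟩

open Classical in
/-- The clauses from which loops in an eventuality are formed: the full merged step clauses for
`◊L(x)`, and only the merged derived step clauses (those with empty `A(x)`, `B(x)`) for `◊l`. -/
noncomputable def candidates (P : Problem σ) : Eventuality σ → Finset (FullMerged σ)
  | .nonGround _ => P.fullMerged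
  | .ground _ => P.mergedDerived.image fun C => ⟨C, ∅⟩

/-- The formula `⋁ⱼ (𝒜ⱼ ∧ Aⱼ(x))` of a set of clauses: the loop formula if the set is a loop. -/
noncomputable def loopFormula (N : Finset (FullMerged σ)) : Formula σ :=
  Formula.bigDisj N FullMerged.lhs

/-- A loop in an eventuality: a non-empty set of clauses that satisfies the loop side conditions
`⊨ ∀x(U ∧ ℬᵢ ∧ Bᵢ(x) ⇒ ¬L(x))` and `⊨ ∀x(U ∧ ℬᵢ ∧ Bᵢ(x) ⇒ ⋁ⱼ (𝒜ⱼ ∧ Aⱼ(x)))`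
(in the ground case the formulae are closed and `∀x` is idle). -/
structure IsLoop (P : Problem σ) (e : Eventuality σ) (N : Finset (FullMerged σ)) : Prop where
  subset : N ⊆ P.candidates e
  nonempty : N.Nonempty
  refutes : ∀ C ∈ N, (Formula.all 0 (.imp (.and P.univConj C.rhs) (.neg e.lit))).Valid
  stays : ∀ C ∈ N, (Formula.all 0 (.imp (.and P.univConj C.rhs) (loopFormula N))).Valid

/-! ### The calculus -/

/-- The conclusion of the eventuality resolution rule applied to a loop:
`∀x ⋀ᵢ (¬𝒜ᵢ ∨ ¬Aᵢ(x))` for `◊L(x)`, and `⋀ᵢ ¬𝒜ᵢ` for `◊l`. -/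
noncomputable def eventualityConclusion (N : Finset (FullMerged σ)) : Eventuality σ → Formula σ
  | .nonGround _ => .all 0 (Formula.bigConj N fun C => .or (.neg C.merged.lhs) (.neg C.sideLhs))
  | .ground _ => Formula.bigConj N fun C => .neg C.merged.lhs

open Classical in
/-- `P.Infers adm φ`: the formula `φ` is the conclusion of an application of the step resolution
rule, or of the (non-ground or ground) eventuality resolution rule, to the problem `P`, where the
eventuality resolution rules may be applied only to loops `N` in `e ∈ E` with `adm P e N`. -/
inductive Infers (adm : Problem σ → Eventuality σ → Finset (FullMerged σ) → Prop)
    (P : Problem σ) : Formula σ → Prop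
  | stepResolution (C : MergedDerived σ) (hC : C ∈ P.mergedDerived)
      (h : Formula.Entails (insert C.rhs P.univ) .fal) : Infers adm P (.neg C.lhs)
  | eventualityResolution (e : Eventuality σ) (he : e ∈ P.eventualities)
      (N : Finset (FullMerged σ)) (hN : P.IsLoop e N) (h : adm P e N) :
      Infers adm P (eventualityConclusion N e)

open Classical in
/-- The termination rules: the initial termination rule, and the (non-ground and ground)
eventuality termination rule. -/
inductive Terminates (P : Problem σ) : Prop
  | initial (h : Formula.Entails (P.univ ∪ P.init) .fal) : Terminates P
  | eventuality (L : Lit σ 1) (hL : L ∈ P.evs)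
      (h : Formula.Entails P.univ (.all 0 (.neg (L.at x)))) : Terminates P
  | groundEventuality (l : Lit σ 0) (hl : l ∈ P.groundEvs)
      (h : Formula.Entails P.univ (.neg (l.at x))) : Terminates P

open Classical in
/-- There is a successfully terminating derivation from `P` in which the eventuality resolution
rules are applied to admissible loops only: a sequence `U = U₀ ⊆ U₁ ⊆ … ⊆ Uₙ` of universal parts,
each extending the previous one by the conclusion of a rule, after which a termination rule
applies. The other parts of the problem do not change. -/
def Refutable (adm : Problem σ → Eventuality σ → Finset (FullMerged σ) → Prop)
    (P : Problem σ) : Prop :=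
  ∃ (n : ℕ) (U : ℕ → Finset (Formula σ)), U 0 = P.univ ∧
    (∀ k < n, ∃ φ, Infers adm { P with univ := U k } φ ∧ U (k + 1) = insert φ (U k)) ∧
    Terminates { P with univ := U n }

/-! ### Breadth-first loop search -/

open Classical in
/-- The set `Nᵢ₊₁` computed from `Hᵢ = H`: all candidate clauses with
`⊨ ∀x(U ∧ ℬ ∧ B(x) ⇒ ¬L(x) ∧ H(x))`. -/
noncomputable def bfsNext (P : Problem σ) (e : Eventuality σ) (H : Formula σ) :
    Finset (FullMerged σ) :=
  (P.candidates e).filter fun C =>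
    (Formula.all 0 (.imp (.and P.univConj C.rhs) (.and (.neg e.lit) H))).Valid

/-- `P.BFSRuns e H N R`: the search for `e`, entering its main loop with `Hᵢ = H`, terminates with
output `R`, and `N` is the last set of clauses that it computes. -/
inductive BFSRuns (P : Problem σ) (e : Eventuality σ) :
    Formula σ → Finset (FullMerged σ) → Formula σ → Prop
  | returnFalse (H : Formula σ) (h : P.bfsNext e H = ∅) : BFSRuns P e H ∅ .fal
  | returnLoop (H : Formula σ) (h : P.bfsNext e H ≠ ∅)
      (hv : (Formula.all 0 (.imp H (loopFormula (P.bfsNext e H)))).Valid) :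
      BFSRuns P e H (P.bfsNext e H) (loopFormula (P.bfsNext e H))
  | iterate (H : Formula σ) (h : P.bfsNext e H ≠ ∅)
      (hv : ¬ (Formula.all 0 (.imp H (loopFormula (P.bfsNext e H)))).Valid)
      (N : Finset (FullMerged σ)) (R : Formula σ)
      (hr : BFSRuns P e (loopFormula (P.bfsNext e H)) N R) : BFSRuns P e H N R

/-- The breadth-first search for `e`, which starts with `H₀ = true`, terminates with output `R`,
and `N` is the last set of clauses that it computes. -/
def BFSReturns (P : Problem σ) (e : Eventuality σ) (N : Finset (FullMerged σ))
    (R : Formula σ) : Prop := P.BFSRuns e .tru N R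

/-- `N` is the loop found by the breadth-first search for `e` (the search does not fail). -/
def FoundByBFS (P : Problem σ) (e : Eventuality σ) (N : Finset (FullMerged σ)) : Prop :=
  N.Nonempty ∧ P.BFSReturns e N (loopFormula N)

end Problem

/-! ### Constant flooding -/

/-- The predicate symbols of `σ` with a fresh proposition for every unary literal and constant. -/
inductive FloodPred (σ : Signature) : ℕ → Type
  | old {n : ℕ} (p : σ.Pred n) : FloodPred σ n
  | fresh (L : Lit σ 1) (c : σ.Const) : FloodPred σ 0

/-- The signature of the constant flooded form. -/
abbrev Signature.flood (σ : Signature) : Signature where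
  Const := σ.Const
  Pred := FloodPred σ

/-- A formula of `σ` as a formula of the extended signature. -/
def Formula.flood {σ : Signature} : Formula σ → Formula σ.flood
  | .tru => .tru
  | .fal => .fal
  | .atom p ts => .atom (σ := σ.flood) (FloodPred.old p) ts
  | .neg φ => .neg φ.flood
  | .and φ ψ => .and φ.flood ψ.flood
  | .or φ ψ => .or φ.flood ψ.flood
  | .imp φ ψ => .imp φ.flood ψ.flood
  | .all i φ => .all i φ.flood
  | .ex i φ => .ex i φ.flood

/-- A literal of `σ` as a literal of the extended signature. -/
def Lit.flood {σ : Signature} {n : ℕ} (L : Lit σ n) : Lit σ.flood n :=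
  ⟨L.positive, FloodPred.old L.sym⟩

/-- A step clause of `σ` as a step clause of the extended signature. -/
def StepClause.flood {σ : Signature} {n : ℕ} (s : StepClause σ n) : StepClause σ.flood n :=
  ⟨s.lhs.flood, s.rhs.flood⟩

/-- The fresh proposition that names the ground literal `L(c)`. -/
def Lit.name {σ : Signature} (L : Lit σ 1) (c : σ.Const) : Lit σ.flood 0 :=
  ⟨true, FloodPred.fresh L c⟩

open Classical in
/-- The constant flooded form of `P`: the eventualities `◊L(c)`, for `◊L(x)` in `P` and constants
`c` of `P`, are added. To stay in the normal form, `L(c)` is renamed by a fresh proposition `l`: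
the ground eventuality `◊l` and the universal clause `l ⇒ L(c)` are added. -/
noncomputable def Problem.flood {σ : Signature} (P : Problem σ) : Problem σ.flood where
  univ := P.univ.image Formula.flood ∪
    (P.evs ×ˢ P.consts).image fun Lc =>
      .imp ((Lc.1.name Lc.2).at x) (Lc.1.flood.at (.const Lc.2))
  init := P.init.image Formula.flood
  groundSteps := P.groundSteps.image StepClause.flood
  steps := P.steps.image StepClause.flood
  groundEvs := P.groundEvs.image Lit.flood ∪ (P.evs ×ˢ P.consts).image fun Lc => Lc.1.name Lc.2
  evs := P.evs.image Lit.flood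

end FOTL

/-! Loop search computes a greatest fixed point. Since `bfsNext` is monotone and there are finitely
many candidate clauses, the successive sets decrease and stabilise (`exists_bfsRuns_of_subset`). The
stopping test makes the last set a loop, and every loop survives each round
(`IsLoop.subset_bfsNext`), so the output is the weakest loop formula.

For completeness, a problem that cannot be refuted is extended to a saturated one
(`exists_saturated`), and a temporal model is read off a graph. Its nodes are all models of the
universal part; its points are such models with a distinguished element. The `∃`- and `∀`-derived
clauses are what lets a step between nodes be lifted to elements, forwards and backwards. Step
resolution gives every node a successor. If an eventuality could not be reached from some point, the
clauses firing at the points reachable from it would form a loop (`exists_isLoop`) true at that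
point; the search finds a loop with a weaker formula, whose conclusion already belongs to the
universal part: contradiction. So each eventuality is reachable from each point.

It remains to find one path of nodes over which every element can be continued fairly
(`exists_fair_path`). There may be uncountably many elements, but what can follow an element depends
only on its node and on the finite set of clauses firing at it, so countably many requests have to
be served. The fair runs over that path form the domain of the temporal model. Evaluation at a
moment is a surjection onto the domain at that moment, and without equality this preserves truth.
Constant flooding ensures that the path traced by each constant is a fair run. -/

namespace FOTL

/-! ### Fair paths -/

/-- If from every point each of countably many targets can be reached, then some infinite path
visits each target infinitely often. -/
theorem exists_fair_sequence {X ι : Type*} [Countable ι] {R : X → X → Prop}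
    {P : ι → X → Prop} (serial : ∀ x, ∃ y, R x y)
    (reach : ∀ x i, ∃ y, Relation.TransGen R x y ∧ P i y) (x : X) :
    ∃ f : ℕ → X, f 0 = x ∧ (∀ n, R (f n) (f (n + 1))) ∧ ∀ i n, ∃ m, n ≤ m ∧ P i (f m) := by
  obtain ⟨hι⟩ := nonempty_encodable ι
  -- Phase `n` serves the target coded by the first component of `n.unpair`, so each target is
  -- served in infinitely many phases; a code of no target asks for nothing.
  let P' : ℕ → X → Prop := fun n y =>
    ∀ i, Encodable.decode (α := ι) n.unpair.1 = some i → P i y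
  -- `G n k x`: the target of phase `n` can be reached from `x` in exactly `k + 1` steps.
  let G : ℕ → ℕ → X → Prop := fun n => Nat.rec (fun x => ∃ y, R x y ∧ P' n y)
    fun _ g x => ∃ y, R x y ∧ g y
  have hG : ∀ n x, ∃ k, G n k x := by
    intro n x
    have h : ∃ y, Relation.TransGen R x y ∧ P' n y := by
      rcases h : Encodable.decode (α := ι) n.unpair.1 with _ | i
      · obtain ⟨y, hy⟩ := serial x
        exact ⟨y, .single hy, by simp [P', h]⟩
      · obtain ⟨y, hy, hP⟩ := reach x i
        exact ⟨y, hy, by simpa [P', h] using hP⟩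
    obtain ⟨y, hy, hP⟩ := h
    induction hy using Relation.TransGen.head_induction_on with
    | single h => exact ⟨0, _, h, hP⟩
    | head h _ ih =>
      obtain ⟨k, hk⟩ := ih
      exact ⟨k + 1, _, h, hk⟩
  let d : ℕ → X → ℕ := fun n x => sInf {k | G n k x}
  -- A step along a shortest path to the target either arrives or comes closer, so a greedy walk
  -- completes every phase.
  have hnext : ∀ (n : ℕ) (x : X), ∃ y : X, R x y ∧ (P' n y ∨ d n y < d n x) := by
    intro n x
    have h : G n (d n x) x := Nat.sInf_mem (hG n x)
    rcases hk : d n x with _ | k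
    · rw [hk] at h
      obtain ⟨y, hy, hP⟩ := h
      exact ⟨y, hy, .inl hP⟩
    · rw [hk] at h
      obtain ⟨y, hy, hP⟩ := h
      exact ⟨y, hy, .inr (Nat.lt_succ_of_le (Nat.sInf_le hP))⟩
  classical
  choose g hgR hg using hnext
  let st : ℕ → X × ℕ := fun t => t.rec (x, 0) fun _ p =>
    (g p.2 p.1, if P' p.2 (g p.2 p.1) then p.2 + 1 else p.2)
  have hst : ∀ t, st (t + 1) = (g (st t).2 (st t).1,
    if P' (st t).2 (g (st t).2 (st t).1) then (st t).2 + 1 else (st t).2) := fun _ => rfl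
  have hprog : ∀ k t, d (st t).2 (st t).1 = k →
      ∃ u, t < u ∧ (st u).2 = (st t).2 + 1 ∧ P' (st t).2 (st u).1 := by
    intro k
    induction k using Nat.strong_induction_on with
    | _ k ih =>
      intro t hk
      by_cases hP : P' (st t).2 (g (st t).2 (st t).1)
      · exact ⟨t + 1, t.lt_succ_self, by rw [hst, if_pos hP], by rw [hst]; exact hP⟩
      · have h2 : (st (t + 1)).2 = (st t).2 := by rw [hst, if_neg hP]
        have h1 : (st (t + 1)).1 = g (st t).2 (st t).1 := by rw [hst]
        obtain ⟨u, hu, hu1, hu2⟩ := ih _ (hk ▸ (hg (st t).2 (st t).1).resolve_left hP) (t + 1)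
          (by simp only [h1, h2])
        exact ⟨u, by omega, by rw [hu1, h2], h2 ▸ hu2⟩
  have hall : ∀ n, ∃ t, n ≤ t ∧ (st t).2 = n := by
    intro n
    induction n with
    | zero => exact ⟨0, le_rfl, rfl⟩
    | succ n ih =>
      obtain ⟨t, ht, htn⟩ := ih
      obtain ⟨u, hu, hu1, -⟩ := hprog _ t rfl
      exact ⟨u, by omega, by omega⟩
  refine ⟨fun t => (st t).1, rfl, fun t => hgR _ _, fun i n => ?_⟩
  -- Pairing with `n` selects a phase for `i` whose number, and hence whose time, is at least `n`.
  obtain ⟨t, ht, htn⟩ := hall (Nat.pair (Encodable.encode i) n)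
  obtain ⟨u, hu, -, hP⟩ := hprog _ t rfl
  have := Nat.right_le_pair (Encodable.encode i) n
  exact ⟨u, by omega, hP i (by rw [htn]; simp)⟩

section FairPath

variable {N E T ι : Type*} {π : E → N} {RN : N → N → Prop} {RE : E → E → Prop}

theorem exists_sequence_of_transGen {X : Type*} {R : X → X → Prop} (serial : ∀ x, ∃ y, R x y)
    {x y : X} (h : Relation.TransGen R x y) :
    ∃ f : ℕ → X, f 0 = x ∧ (∀ n, R (f n) (f (n + 1))) ∧ ∃ m, 0 < m ∧ f m = y := by
  let c : X → (ℕ → X) → ℕ → X := fun x f n => Nat.casesOn n x f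
  have cons : ∀ {x y : X} (f : ℕ → X), R x y → f 0 = y → (∀ n, R (f n) (f (n + 1))) →
      ∀ n, R (c x f n) (c x f (n + 1)) := by
    intro x y f hxy h0 hf n
    cases n with
    | zero => simpa [c, h0] using hxy
    | succ n => exact hf n
  induction h using Relation.TransGen.head_induction_on with
  | single h =>
    -- With no targets, a fair sequence is just an infinite path from `y`.
    obtain ⟨f, h0, hf, -⟩ := exists_fair_sequence (ι := Empty) (P := fun _ _ => True)
      serial (fun _ i => i.elim) y
    exact ⟨c _ f, rfl, cons f h h0 hf, 1, one_pos, h0⟩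
  | head h _ ih =>
    obtain ⟨f, h0, hf, m, hm, hfm⟩ := ih
    exact ⟨c _ f, rfl, cons f h h0 hf, m + 1, m.succ_pos, hfm⟩

/-- Forward lifting, one step at a time; the values before `t` are fillers, to be replaced by means
of `exists_run_extending`. -/
theorem exists_run_from (fwd : ∀ e n, RN (π e) n → ∃ e', π e' = n ∧ RE e e') {s : ℕ → N}
    (hs : ∀ t, RN (s t) (s (t + 1))) {t : ℕ} {e : E} (he : π e = s t) :
    ∃ r : ℕ → E, r t = e ∧ ∀ u, t ≤ u → π (r u) = s u ∧ RE (r u) (r (u + 1)) := by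
  have h : ∀ (u : ℕ) (e : E), ∃ e', π e = s u → π e' = s (u + 1) ∧ RE e e' := by
    intro u e
    by_cases he : π e = s u
    · obtain ⟨e', h⟩ := fwd e (s (u + 1)) (he ▸ hs u)
      exact ⟨e', fun _ => h⟩
    · exact ⟨e, fun h => (he h).elim⟩
  choose g hg using h
  let r : ℕ → E := fun n => n.rec e fun k p => g (t + k) p
  have hr : ∀ n, π (r n) = s (t + n) := by
    intro n
    induction n with
    | zero => exact he
    | succ n ih => exact (hg _ _ ih).1
  refine ⟨fun u => r (u - t), by simp [r], fun u hu => ?_⟩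
  obtain ⟨n, rfl⟩ := Nat.exists_eq_add_of_le hu
  have h1 : t + n - t = n := by omega
  have h2 : t + n + 1 - t = n + 1 := by omega
  simp only [h1, h2]
  exact ⟨hr n, (hg _ _ (hr n)).2⟩

/-- Backward lifting supplies the finitely many moments before `t`, from the latest to the earliest.
-/
theorem exists_run_extending (bwd : ∀ n e, RN n (π e) → ∃ e', π e' = n ∧ RE e' e) {s : ℕ → N}
    (hs : ∀ t, RN (s t) (s (t + 1))) (t : ℕ) (r : ℕ → E)
    (hr : ∀ u, t ≤ u → π (r u) = s u ∧ RE (r u) (r (u + 1))) :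
    ∃ r' : ℕ → E, (∀ u, t ≤ u → r' u = r u) ∧ ∀ u, π (r' u) = s u ∧ RE (r' u) (r' (u + 1)) := by
  induction t generalizing r with
  | zero => exact ⟨r, fun _ _ => rfl, fun u => hr u u.zero_le⟩
  | succ t ih =>
    obtain ⟨e, he, hR⟩ := bwd (s t) (r (t + 1)) ((hr (t + 1) le_rfl).1 ▸ hs t)
    obtain ⟨r', h1, h2⟩ := ih (Function.update r t e) (by
      intro u hu
      rcases hu.eq_or_lt with rfl | hu
      · simpa using ⟨he, hR⟩
      · rw [Function.update_of_ne (by omega), Function.update_of_ne (by omega)]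
        exact hr u hu)
    exact ⟨r', fun u hu => by rw [h1 u (by omega), Function.update_of_ne (by omega)], h2⟩

/-- Points `e : E` lie over nodes `π e : N`, and every step between nodes lifts to points, forwards
from every point and backwards from every point. If the successors of a point depend only on its
node and on its colour, and each target can be reached from every point, then there is a path of
nodes such that every point over it lies on a run that visits each target infinitely often. -/
theorem exists_fair_path [Countable T] [Countable ι] {τ : E → T} {L : ι → E → Prop}
    (proj : ∀ e e', RE e e' → RN (π e) (π e'))
    (serial : ∀ n, ∃ n', RN n n')
    (fwd : ∀ e n, RN (π e) n → ∃ e', π e' = n ∧ RE e e')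
    (bwd : ∀ n e, RN n (π e) → ∃ e', π e' = n ∧ RE e' e)
    (colour : ∀ e e' f, π e = π e' → τ e = τ e' → RE e f → RE e' f)
    (reach : ∀ e i, ∃ e', Relation.TransGen RE e e' ∧ L i e') (n : N) :
    ∃ s : ℕ → N, s 0 = n ∧ (∀ t, RN (s t) (s (t + 1))) ∧ ∀ t e, π e = s t →
      ∃ r : ℕ → E, r t = e ∧ (∀ u, π (r u) = s u) ∧ (∀ u, RE (r u) (r (u + 1))) ∧
        ∀ i u, ∃ v, u ≤ v ∧ L i (r v) := by
  have serialE : ∀ e, ∃ e', RE e e' := fun e =>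
    let ⟨n, hn⟩ := serial (π e)
    let ⟨e', _, h⟩ := fwd e n hn
    ⟨e', h⟩
  -- A state is an infinite node path that is fixed up to moment `p.1.2`; `R` fixes one more moment
  -- and may change the path beyond the part already fixed.
  let X := {p : (ℕ → N) × ℕ // ∀ t, RN (p.1 t) (p.1 (t + 1))}
  let R : X → X → Prop := fun p q => q.1.2 = p.1.2 + 1 ∧ ∀ t, t ≤ p.1.2 → q.1.1 t = p.1.1 t
  -- Request `(t, c, i)`: every point of colour `c` over moment `t` has a run that meets target `i`
  -- after `t` but within the fixed part. Requests are countable even if points are not.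
  let P : ℕ × T × ι → X → Prop := fun o p => o.1 ≤ p.1.2 ∧
    ∀ e, π e = p.1.1 o.1 → τ e = o.2.1 → ∃ r : ℕ → E, r o.1 = e ∧
      (∀ u, o.1 ≤ u → π (r u) = p.1.1 u ∧ RE (r u) (r (u + 1))) ∧
      ∃ j, o.1 < j ∧ j ≤ p.1.2 ∧ L o.2.2 (r j)
  have hext : ∀ (p q : X), p.1.2 < q.1.2 → (∀ t, t ≤ p.1.2 → q.1.1 t = p.1.1 t) →
      Relation.TransGen R p q := by
    rintro p ⟨⟨s, k⟩, hs⟩ hlt heq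
    have : ∀ d, Relation.TransGen R p ⟨(s, p.1.2 + 1 + d), hs⟩ := by
      intro d
      induction d with
      | zero => exact .single ⟨rfl, heq⟩
      | succ d ih => exact ih.tail ⟨rfl, fun _ _ => rfl⟩
    obtain ⟨d, rfl⟩ := Nat.exists_eq_add_of_lt hlt
    simpa [add_right_comm] using this d
  obtain ⟨s₀, hs₀, hs₀R, -⟩ := exists_fair_sequence (ι := Empty) (P := fun _ _ => True)
    serial (fun _ i => i.elim) n
  obtain ⟨f, hf0, hfR, hfP⟩ := exists_fair_sequence (R := R) (P := P)
    (fun p => ⟨⟨(p.1.1, p.1.2 + 1), p.2⟩, rfl, fun _ _ => rfl⟩)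
    (by
      rintro ⟨⟨s, k⟩, hs⟩ ⟨t, c, i⟩
      -- The path is changed only after `k₁`, beyond both its fixed part and moment `t`.
      obtain ⟨k₁, hk₁⟩ : ∃ k₁, k₁ = max k t + 1 := ⟨_, rfl⟩
      by_cases hc : ∃ e, π e = s t ∧ τ e = c
      · obtain ⟨e, he, rfl⟩ := hc
        obtain ⟨r, hrt, hr⟩ := exists_run_from fwd hs he
        obtain ⟨e', he', hL⟩ := reach (r k₁) i
        obtain ⟨q, hq0, hq, m, hm, rfl⟩ := exists_sequence_of_transGen serialE he'
        -- Follow the old path up to `k₁`, then a sequence of points that reaches the target; the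
        -- new node path is its projection.
        let r' : ℕ → E := fun u => if u ≤ k₁ then r u else q (u - k₁)
        let s' : ℕ → N := fun u => if u ≤ k₁ then s u else π (q (u - k₁))
        have hr1 : ∀ u, u ≤ k₁ → r' u = r u := fun u hu => if_pos hu
        have hs1 : ∀ u, u ≤ k₁ → s' u = s u := fun u hu => if_pos hu
        have hr2 : ∀ d, r' (k₁ + d) = q d := by
          intro d
          rcases d.eq_zero_or_pos with rfl | hd
          · rw [hq0, add_zero, hr1 _ le_rfl]
          · simp only [r']
            rw [if_neg (by omega), Nat.add_sub_cancel_left]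
        have hs2 : ∀ d, s' (k₁ + d) = π (q d) := by
          intro d
          rcases d.eq_zero_or_pos with rfl | hd
          · rw [hq0, add_zero, hs1 _ le_rfl, (hr _ (by omega)).1]
          · simp only [s']
            rw [if_neg (by omega), Nat.add_sub_cancel_left]
        have hs' : ∀ u, RN (s' u) (s' (u + 1)) := by
          intro u
          rcases lt_or_ge u k₁ with hu | hu
          · rw [hs1 _ hu.le, hs1 _ hu]
            exact hs u
          · obtain ⟨d, rfl⟩ := Nat.exists_eq_add_of_le hu
            rw [add_assoc, hs2, hs2]
            exact proj _ _ (hq d)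
        have hr' : ∀ u, t ≤ u → π (r' u) = s' u ∧ RE (r' u) (r' (u + 1)) := by
          intro u hu
          rcases lt_or_ge u k₁ with huk | huk
          · rw [hs1 _ huk.le, hr1 _ huk.le, hr1 _ huk]
            exact hr u hu
          · obtain ⟨d, rfl⟩ := Nat.exists_eq_add_of_le huk
            rw [add_assoc, hs2, hr2, hr2]
            exact ⟨rfl, hq d⟩
        refine ⟨⟨(s', k₁ + m), hs'⟩, hext _ _ (by simp only; omega)
          (fun u hu => hs1 u (by simp only at hu; omega)), by simp only; omega, ?_⟩
        -- One run serves all points of the colour: it suffices to replace its value at `t`, since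
        -- the next step depends only on node and colour.
        intro e₁ he₁ hτ
        refine ⟨Function.update r' t e₁, by simp, fun u hu => ?_, k₁ + m, by simp only; omega,
          le_rfl, ?_⟩
        · rw [Function.update_of_ne (Nat.lt_succ_of_le hu).ne']
          rcases hu.eq_or_lt with rfl | hu'
          · simp only [Function.update_self]
            refine ⟨he₁, colour e e₁ _ ?_ hτ.symm ?_⟩
            · rw [he, he₁]
              exact (hs1 t (by omega)).symm
            · have := (hr' t le_rfl).2
              rwa [hr1 t (by omega), hrt] at this
          · rw [Function.update_of_ne hu'.ne']
            exact hr' u hu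
        · rw [Function.update_of_ne (show k₁ + m ≠ t by omega), hr2]
          exact hL
      · refine ⟨⟨(s, k₁), hs⟩, hext _ _ (by simp only; omega) (fun _ _ => rfl),
          by simp only; omega, fun e he hτ => (hc ⟨e, he, hτ⟩).elim⟩)
    ⟨(s₀, 0), hs₀R⟩
  -- Diagonal limit: moment `t` is fixed in stage `t` and never changes afterwards.
  let S : ℕ → N := fun t => (f t).1.1 t
  have hft : ∀ t, (f t).1.2 = t := by
    intro t
    induction t with
    | zero => rw [hf0]
    | succ t ih => rw [(hfR t).1, ih]
  have hfS : ∀ t d, (f (t + d)).1.1 t = S t := by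
    intro t d
    induction d with
    | zero => rfl
    | succ d ih => rw [← ih, ← add_assoc, (hfR (t + d)).2 t (by rw [hft]; omega)]
  have hS : ∀ t, RN (S t) (S (t + 1)) := by
    intro t
    rw [← hfS t 1]
    exact (f (t + 1)).2 t
  refine ⟨S, by simp only [S, hf0]; exact hs₀, hS, fun t e he => ?_⟩
  -- Requests granted within a fixed part persist in the limit, so each target is reachable from
  -- each point over `S`; a second fair sequence then visits them all infinitely often.
  let Y := {p : ℕ × E // π p.2 = S p.1}
  let Q : Y → Y → Prop := fun p q => q.1.1 = p.1.1 + 1 ∧ RE p.1.2 q.1.2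
  have hQ : ∀ p : Y, ∃ q, Q p q := by
    rintro ⟨⟨t, e⟩, he⟩
    obtain ⟨e', he', hR⟩ := fwd e (S (t + 1)) (by rw [show π e = S t from he]; exact hS t)
    exact ⟨⟨(t + 1, e'), he'⟩, rfl, hR⟩
  obtain ⟨g, hg0, hgQ, hgL⟩ := exists_fair_sequence (R := Q) (P := fun i p => L i p.1.2) hQ
    (by
      rintro ⟨⟨t, e⟩, he⟩ i
      obtain ⟨m, -, htm, hm⟩ := hfP (t, τ e, i) 0
      rw [hft] at htm hm
      have hSm : ∀ u, u ≤ m → (f m).1.1 u = S u := by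
        intro u hu
        obtain ⟨d, rfl⟩ := Nat.exists_eq_add_of_le hu
        exact hfS u d
      obtain ⟨r, hrt, hr, j, htj, hjm, hL⟩ := hm e (he.trans (hSm t htm).symm) rfl
      simp only at hrt hr htj hL
      have key : ∀ d (hd : t + d + 1 ≤ m), Relation.TransGen Q ⟨(t, e), he⟩
          ⟨(t + d + 1, r (t + d + 1)), by
            rw [← hSm _ hd]; exact (hr _ (by omega)).1⟩ := by
        intro d
        induction d with
        | zero =>
          intro hd
          refine .single ⟨rfl, ?_⟩
          have := (hr t le_rfl).2
          rwa [hrt] at this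
        | succ d ih =>
          intro hd
          exact (ih (by omega)).tail ⟨rfl, (hr _ (by omega)).2⟩
      obtain ⟨d, rfl⟩ := Nat.exists_eq_add_of_lt htj
      exact ⟨_, key d hjm, hL⟩)
    ⟨(t, e), he⟩
  have hgt : ∀ d, (g d).1.1 = t + d := by
    intro d
    induction d with
    | zero => rw [hg0]; rfl
    | succ d ih => rw [(hgQ d).1, ih, add_assoc]
  obtain ⟨r, hr1, hr2⟩ := exists_run_extending bwd hS t (fun u => (g (u - t)).1.2) (by
    intro u hu
    obtain ⟨d, rfl⟩ := Nat.exists_eq_add_of_le hu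
    have h1 : t + d - t = d := by omega
    have h2 : t + d + 1 - t = d + 1 := by omega
    simp only [h1, h2]
    exact ⟨by rw [(g d).2, hgt], (hgQ d).2⟩)
  refine ⟨r, by rw [hr1 t le_rfl]; simp [hg0], fun u => (hr2 u).1, fun u => (hr2 u).2,
    fun i u => ?_⟩
  obtain ⟨v, hv, hL⟩ := hgL i u
  refine ⟨t + v, by omega, ?_⟩
  rw [hr1 _ (by omega), Nat.add_sub_cancel_left]
  exact hL

end FairPath

/-! ### Semantics -/

namespace Formula

variable {σ : Signature}

theorem truth_conj (M : Structure σ) (a : ℕ → M.D) (l : List (Formula σ)) :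
    Truth M a (conj l) ↔ ∀ φ ∈ l, Truth M a φ := by
  induction l with
  | nil => simp [conj, Truth]
  | cons φ l ih => simp only [conj, List.foldr_cons, Truth, List.forall_mem_cons] at ih ⊢; rw [ih]

theorem truth_disj (M : Structure σ) (a : ℕ → M.D) (l : List (Formula σ)) :
    Truth M a (disj l) ↔ ∃ φ ∈ l, Truth M a φ := by
  induction l with
  | nil => simp [disj, Truth]
  | cons φ l ih => simp only [disj, List.foldr_cons, Truth, List.exists_mem_cons_iff] at ih ⊢; rw [ih]

@[simp] theorem truth_bigConj {ι : Type} (M : Structure σ) (a : ℕ → M.D) (s : Finset ι)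
    (f : ι → Formula σ) : Truth M a (bigConj s f) ↔ ∀ i ∈ s, Truth M a (f i) := by
  simp [bigConj, truth_conj]

@[simp] theorem truth_bigDisj {ι : Type} (M : Structure σ) (a : ℕ → M.D) (s : Finset ι)
    (f : ι → Formula σ) : Truth M a (bigDisj s f) ↔ ∃ i ∈ s, Truth M a (f i) := by
  simp [bigDisj, truth_disj]

theorem consts_conj {l : List (Formula σ)} {s : Finset σ.Const} (h : ∀ φ ∈ l, φ.consts ⊆ s) :
    (conj l).consts ⊆ s := by
  classical
  induction l with
  | nil => simp [conj, consts]
  | cons φ l ih =>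
    simp only [List.forall_mem_cons] at h
    exact Finset.union_subset h.1 (ih h.2)

theorem consts_disj {l : List (Formula σ)} {s : Finset σ.Const} (h : ∀ φ ∈ l, φ.consts ⊆ s) :
    (disj l).consts ⊆ s := by
  classical
  induction l with
  | nil => simp [disj, consts]
  | cons φ l ih =>
    simp only [List.forall_mem_cons] at h
    exact Finset.union_subset h.1 (ih h.2)

theorem consts_bigConj {ι : Type} {t : Finset ι} {f : ι → Formula σ} {s : Finset σ.Const}
    (h : ∀ i ∈ t, (f i).consts ⊆ s) : (bigConj t f).consts ⊆ s :=
  consts_conj (by simpa using h)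

theorem consts_bigDisj {ι : Type} {t : Finset ι} {f : ι → Formula σ} {s : Finset σ.Const}
    (h : ∀ i ∈ t, (f i).consts ⊆ s) : (bigDisj t f).consts ⊆ s :=
  consts_disj (by simpa using h)

/-- Formulae whose truth does not depend on the assignment. -/
def IsSentence (φ : Formula σ) : Prop :=
  ∀ (M : Structure σ) (a b : ℕ → M.D), Truth M a φ → Truth M b φ

theorem _root_.FOTL.Tm.eval_congr {C D : Type} (I : C → D) {a b : ℕ → D} {t : Tm C}
    (h : ∀ i ∈ t.vars, a i = b i) : t.eval I a = t.eval I b := by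
  cases t with
  | var i => exact h i (by simp [Tm.vars])
  | const c => rfl

theorem truth_congr (M : Structure σ) (φ : Formula σ) {a b : ℕ → M.D}
    (h : ∀ i ∈ φ.freeVars, a i = b i) : Truth M a φ ↔ Truth M b φ := by
  have upd : ∀ {a b : ℕ → M.D} {i : ℕ} {s : Finset ℕ}, (∀ j ∈ s.erase i, a j = b j) →
      ∀ d, ∀ j ∈ s, Function.update a i d j = Function.update b i d j := by
    intro a b i s h d j hj
    by_cases hji : j = i
    · subst hji; simp
    · simp [hji, h j (Finset.mem_erase.2 ⟨hji, hj⟩)]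
  induction φ generalizing a b with
  | tru => rfl
  | fal => rfl
  | atom p ts =>
    simp only [Truth]
    rw [show (fun k => (ts k).eval M.const a) = fun k => (ts k).eval M.const b from
      funext fun k => Tm.eval_congr _ fun i hi => h i (by
        simp only [freeVars, Finset.mem_biUnion]; exact ⟨k, Finset.mem_univ _, hi⟩)]
  | neg φ ih => exact not_congr (ih h)
  | and φ ψ ih1 ih2 =>
    simp only [freeVars, Finset.mem_union] at h
    exact and_congr (ih1 fun i hi => h i (.inl hi)) (ih2 fun i hi => h i (.inr hi))
  | or φ ψ ih1 ih2 =>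
    simp only [freeVars, Finset.mem_union] at h
    exact or_congr (ih1 fun i hi => h i (.inl hi)) (ih2 fun i hi => h i (.inr hi))
  | imp φ ψ ih1 ih2 =>
    simp only [freeVars, Finset.mem_union] at h
    exact imp_congr (ih1 fun i hi => h i (.inl hi)) (ih2 fun i hi => h i (.inr hi))
  | all i φ ih => exact forall_congr' fun d => ih (upd h d)
  | ex i φ ih => exact exists_congr fun d => ih (upd h d)

theorem Closed.isSentence {φ : Formula σ} (h : φ.Closed) : φ.IsSentence := fun M _ _ =>
  (truth_congr M φ (by rw [h]; simp)).1

theorem valid_all_imp {i : ℕ} {φ ψ : Formula σ} :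
    (all i (imp φ ψ)).Valid ↔ ∀ (M : Structure σ) (a : ℕ → M.D), Truth M a φ → Truth M a ψ := by
  constructor
  · intro h M a
    simpa [Truth] using h M a (a i)
  · intro h M a d
    exact h M _

/-- Formulae without equality cannot distinguish structures related by a surjection that preserves
and reflects the predicates, as long as it respects the constants of the formula. -/
theorem truth_comp {M N : Structure σ} {h : M.D → N.D} (hsurj : Function.Surjective h)
    (hpred : ∀ {n} (p : σ.Pred n) (v : Fin n → M.D), M.pred p v ↔ N.pred p (h ∘ v))
    (φ : Formula σ) (hconst : ∀ c ∈ φ.consts, h (M.const c) = N.const c) (a : ℕ → M.D) :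
    Truth M a φ ↔ Truth N (h ∘ a) φ := by
  induction φ generalizing a with
  | tru => rfl
  | fal => rfl
  | atom p ts =>
    simp only [Truth]
    rw [hpred]
    congr! 1
    funext k
    have hk : ∀ c ∈ (ts k).consts, h (M.const c) = N.const c := fun c hc =>
      hconst c (by simp only [consts, Finset.mem_biUnion]; exact ⟨k, Finset.mem_univ _, hc⟩)
    simp only [Function.comp]
    generalize ts k = t at hk
    cases t with
    | var i => rfl
    | const c => exact hk c (by simp [Tm.consts])
  | neg φ ih => exact not_congr (ih hconst a)
  | and φ ψ ih1 ih2 =>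
    simp only [consts, Finset.mem_union] at hconst
    exact and_congr (ih1 (fun c hc => hconst c (.inl hc)) a) (ih2 (fun c hc => hconst c (.inr hc)) a)
  | or φ ψ ih1 ih2 =>
    simp only [consts, Finset.mem_union] at hconst
    exact or_congr (ih1 (fun c hc => hconst c (.inl hc)) a) (ih2 (fun c hc => hconst c (.inr hc)) a)
  | imp φ ψ ih1 ih2 =>
    simp only [consts, Finset.mem_union] at hconst
    exact imp_congr (ih1 (fun c hc => hconst c (.inl hc)) a)
      (ih2 (fun c hc => hconst c (.inr hc)) a)
  | all i φ ih =>
    simp only [Truth]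
    rw [hsurj.forall]
    exact forall_congr' fun d => by rw [ih hconst, Function.comp_update]
  | ex i φ ih =>
    simp only [Truth]
    rw [hsurj.exists]
    exact exists_congr fun d => by rw [ih hconst, Function.comp_update]

/-! ### Truth in the flooded signature -/

theorem consts_flood (φ : Formula σ) : φ.flood.consts = φ.consts := by
  induction φ <;> simp_all [flood, consts]

/-- The reduct of a structure of the extended signature. -/
def _root_.FOTL.Structure.reduct (M : Structure σ.flood) : Structure σ where
  D := M.D
  nonempty := M.nonempty
  const := M.const
  pred p v := M.pred (FloodPred.old p) v

theorem truth_flood (M : Structure σ.flood) (a : ℕ → M.D) (φ : Formula σ) :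
    Truth M a φ.flood ↔ Truth M.reduct a φ := by
  induction φ generalizing a with
  | tru => rfl
  | fal => rfl
  | atom p ts => rfl
  | neg φ ih => exact not_congr (ih a)
  | and φ ψ ih1 ih2 => exact and_congr (ih1 a) (ih2 a)
  | or φ ψ ih1 ih2 => exact or_congr (ih1 a) (ih2 a)
  | imp φ ψ ih1 ih2 => exact imp_congr (ih1 a) (ih2 a)
  | all i φ ih => exact forall_congr' fun d => ih _
  | ex i φ ih => exact exists_congr fun d => ih _

theorem IsSentence.flood {φ : Formula σ} (h : φ.IsSentence) : φ.flood.IsSentence := by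
  intro M a b
  rw [truth_flood, truth_flood]
  exact h M.reduct a b

end Formula

open Formula

variable {σ : Signature}

/-- The literal holds of `d` (which is irrelevant for propositional literals). -/
def Lit.Holds {n : ℕ} (L : Lit σ n) (M : Structure σ) (d : M.D) : Prop :=
  match L.positive with
  | true => M.pred L.sym fun _ => d
  | false => ¬ M.pred L.sym fun _ => d

@[simp] theorem Lit.truth_at {n : ℕ} (L : Lit σ n) (M : Structure σ) (a : ℕ → M.D)
    (t : Tm σ.Const) : Truth M a (L.at t) ↔ L.Holds M (t.eval M.const a) := by
  unfold Lit.at Lit.Holds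
  cases L.positive <;> rfl

theorem Lit.holds_ground (l : Lit σ 0) (M : Structure σ) (d e : M.D) :
    l.Holds M d ↔ l.Holds M e := by
  unfold Lit.Holds
  rw [show (fun _ : Fin 0 => d) = fun _ => e from Subsingleton.elim _ _]

theorem Lit.consts_at {n : ℕ} (L : Lit σ n) (t : Tm σ.Const) : (L.at t).consts ⊆ t.consts := by
  unfold Lit.at
  cases L.positive <;> simp [Formula.consts]

@[simp] theorem eval_x {C D : Type} (I : C → D) (a : ℕ → D) : (x : Tm C).eval I a = a 0 := rfl

@[simp] theorem eval_const {C D : Type} (I : C → D) (a : ℕ → D) (c : C) :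
    (Tm.const c).eval I a = I c := rfl

/-- `l` or `L(d)`. -/
def Eventuality.Holds (e : Eventuality σ) (M : Structure σ) (d : M.D) : Prop :=
  match e with
  | .ground l => l.Holds M d
  | .nonGround L => L.Holds M d

@[simp] theorem Eventuality.truth_lit (e : Eventuality σ) (M : Structure σ) (a : ℕ → M.D) :
    Truth M a e.lit ↔ e.Holds M (a 0) := by
  cases e <;> simp [Eventuality.lit, Eventuality.Holds]

/-! ### Semantics of merged clauses -/

namespace Mergeable

/-- The left-hand side is true in `M`. -/
def LhsHolds (M : Structure σ) : Mergeable σ → Prop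
  | ground s => ∃ d, s.lhs.Holds M d
  | forallDisj s => ∀ d, ∃ t ∈ s, t.lhs.Holds M d
  | existsConj s => ∃ d, ∀ t ∈ s, t.lhs.Holds M d
  | inst s c => s.lhs.Holds M (M.const c)

/-- The right-hand side is true in `M`. -/
def RhsHolds (M : Structure σ) : Mergeable σ → Prop
  | ground s => ∃ d, s.rhs.Holds M d
  | forallDisj s => ∀ d, ∃ t ∈ s, t.rhs.Holds M d
  | existsConj s => ∃ d, ∀ t ∈ s, t.rhs.Holds M d
  | inst s c => s.rhs.Holds M (M.const c)

theorem _root_.FOTL.Lit.holds_iff_exists (l : Lit σ 0) (M : Structure σ) (d : M.D) :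
    l.Holds M d ↔ ∃ d, l.Holds M d :=
  ⟨fun h => ⟨d, h⟩, fun ⟨_, h⟩ => (l.holds_ground M _ _).1 h⟩

@[simp] theorem truth_lhs (m : Mergeable σ) (M : Structure σ) (a : ℕ → M.D) :
    Truth M a m.lhs ↔ m.LhsHolds M := by
  cases m with
  | ground s => simpa [lhs, LhsHolds] using s.lhs.holds_iff_exists M (a 0)
  | _ => simp [lhs, LhsHolds, Truth]

@[simp] theorem truth_rhs (m : Mergeable σ) (M : Structure σ) (a : ℕ → M.D) :
    Truth M a m.rhs ↔ m.RhsHolds M := by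
  cases m with
  | ground s => simpa [rhs, RhsHolds] using s.rhs.holds_iff_exists M (a 0)
  | _ => simp [rhs, RhsHolds, Truth]

end Mergeable

@[simp] theorem MergedDerived.truth_lhs (C : MergedDerived σ) (M : Structure σ) (a : ℕ → M.D) :
    Truth M a C.lhs ↔ ∀ m ∈ C, m.LhsHolds M := by
  simp [MergedDerived.lhs]

@[simp] theorem MergedDerived.truth_rhs (C : MergedDerived σ) (M : Structure σ) (a : ℕ → M.D) :
    Truth M a C.rhs ↔ ∀ m ∈ C, m.RhsHolds M := by
  simp [MergedDerived.rhs]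

@[simp] theorem FullMerged.truth_sideLhs (C : FullMerged σ) (M : Structure σ) (a : ℕ → M.D) :
    Truth M a C.sideLhs ↔ ∀ s ∈ C.side, s.lhs.Holds M (a 0) := by
  simp [FullMerged.sideLhs]

@[simp] theorem FullMerged.truth_lhs (C : FullMerged σ) (M : Structure σ) (a : ℕ → M.D) :
    Truth M a C.lhs ↔ (∀ m ∈ C.merged, m.LhsHolds M) ∧ ∀ s ∈ C.side, s.lhs.Holds M (a 0) := by
  simp [FullMerged.lhs, Truth]

@[simp] theorem FullMerged.truth_rhs (C : FullMerged σ) (M : Structure σ) (a : ℕ → M.D) :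
    Truth M a C.rhs ↔ (∀ m ∈ C.merged, m.RhsHolds M) ∧ ∀ s ∈ C.side, s.rhs.Holds M (a 0) := by
  simp [FullMerged.rhs, FullMerged.sideRhs, Truth]

namespace Problem

variable {P : Problem σ}

@[simp] theorem truth_loopFormula (N : Finset (FullMerged σ)) (M : Structure σ) (a : ℕ → M.D) :
    Truth M a (loopFormula N) ↔ ∃ C ∈ N, Truth M a C.lhs := by
  simp [loopFormula]

@[simp] theorem truth_univConj (M : Structure σ) (a : ℕ → M.D) :
    Truth M a P.univConj ↔ ∀ φ ∈ P.univ, Truth M a φ := by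
  simp [univConj]

/-! ### Breadth-first loop search -/

theorem mem_bfsNext {e : Eventuality σ} {H : Formula σ} {C : FullMerged σ} :
    C ∈ P.bfsNext e H ↔ C ∈ P.candidates e ∧ ∀ (M : Structure σ) (a : ℕ → M.D),
      (∀ φ ∈ P.univ, Truth M a φ) → Truth M a C.rhs → ¬ Truth M a e.lit ∧ Truth M a H := by
  simp only [bfsNext, Finset.mem_filter, valid_all_imp, Truth, truth_univConj, and_imp]

theorem bfsNext_mono {e : Eventuality σ} {H H' : Formula σ}
    (h : ∀ (M : Structure σ) (a : ℕ → M.D), Truth M a H → Truth M a H') :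
    P.bfsNext e H ⊆ P.bfsNext e H' := fun C hC => by
  rw [mem_bfsNext] at hC ⊢
  exact ⟨hC.1, fun M a hU hr => (hC.2 M a hU hr).imp_right (h M a)⟩

theorem loopFormula_mono {N N' : Finset (FullMerged σ)} (h : N ⊆ N') (M : Structure σ)
    (a : ℕ → M.D) (hN : Truth M a (loopFormula N)) : Truth M a (loopFormula N') := by
  rw [truth_loopFormula] at hN ⊢
  obtain ⟨C, hC, hl⟩ := hN
  exact ⟨C, h hC, hl⟩

/-- By monotonicity the set of clauses shrinks, and a round that leaves it unchanged passes the
stopping test; hence induction on the finite set. -/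
theorem exists_bfsRuns_of_subset {e : Eventuality σ} (N : Finset (FullMerged σ))
    (h : P.bfsNext e (loopFormula N) ⊆ N) : ∃ K R, P.BFSRuns e (loopFormula N) K R := by
  induction N using Finset.strongInduction with
  | _ N ih =>
    by_cases h0 : P.bfsNext e (loopFormula N) = ∅
    · exact ⟨_, _, .returnFalse _ h0⟩
    by_cases hv : (all 0 (imp (loopFormula N) (loopFormula (P.bfsNext e (loopFormula N))))).Valid
    · exact ⟨_, _, .returnLoop _ h0 hv⟩
    · obtain ⟨K, R, hr⟩ := ih _ (h.ssubset_of_ne fun heq => hv (by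
        rw [heq, valid_all_imp]; exact fun _ _ => id)) (bfsNext_mono (loopFormula_mono h))
      exact ⟨K, R, .iterate _ h0 hv _ _ hr⟩

theorem exists_bfsReturns (P : Problem σ) (e : Eventuality σ) : ∃ N R, P.BFSReturns e N R := by
  by_cases h0 : P.bfsNext e .tru = ∅
  · exact ⟨_, _, .returnFalse _ h0⟩
  by_cases hv : (all 0 (imp .tru (loopFormula (P.bfsNext e .tru)))).Valid
  · exact ⟨_, _, .returnLoop _ h0 hv⟩
  · obtain ⟨K, R, hr⟩ := exists_bfsRuns_of_subset (P := P) (e := e) (P.bfsNext e .tru)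
      (bfsNext_mono fun _ _ _ => trivial)
    exact ⟨K, R, .iterate _ h0 hv _ _ hr⟩

/-- The clauses of the last set lead into the previous formula, which by the stopping test implies
the formula of that very set. -/
theorem BFSRuns.eq_or_isLoop {e : Eventuality σ} {H R : Formula σ} {N : Finset (FullMerged σ)}
    (h : P.BFSRuns e H N R) :
    (N = ∅ ∧ R = .fal) ∨ (P.IsLoop e N ∧ R = loopFormula N) := by
  induction h with
  | returnFalse H h => exact .inl ⟨rfl, rfl⟩
  | returnLoop H h hv =>
    rw [valid_all_imp] at hv
    refine .inr ⟨⟨fun C hC => (mem_bfsNext.1 hC).1, Finset.nonempty_iff_ne_empty.2 h, ?_, ?_⟩, rfl⟩ <;>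
    · intro C hC
      rw [valid_all_imp]
      rintro M a ⟨hU, hr⟩
      have := (mem_bfsNext.1 hC).2 M a (by simpa using hU) hr
      first | exact this.1 | exact hv M a this.2
  | iterate H h hv N R hr ih => exact ih

/-- Invariant of the search: the clauses of a loop lead back into its own formula, so no round
discards them while that formula implies the current one. -/
theorem IsLoop.subset_bfsNext {e : Eventuality σ} {K : Finset (FullMerged σ)} (hK : P.IsLoop e K)
    {H : Formula σ}
    (h : ∀ (M : Structure σ) (a : ℕ → M.D), Truth M a (loopFormula K) → Truth M a H) :
    K ⊆ P.bfsNext e H := by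
  intro C hC
  have h1 := hK.refutes C hC
  have h2 := hK.stays C hC
  rw [valid_all_imp] at h1 h2
  refine mem_bfsNext.2 ⟨hK.subset hC, fun M a hU hr => ?_⟩
  have hr : Truth M a (.and P.univConj C.rhs) := ⟨by simpa using hU, hr⟩
  exact ⟨h1 M a hr, h M a (h2 M a hr)⟩

/-- `K` survives every round, so its formula implies each intermediate one; since `K` is non-empty,
the search cannot fail. -/
theorem BFSRuns.loopFormula_imp {e : Eventuality σ} {H R : Formula σ} {N : Finset (FullMerged σ)}
    (hr : P.BFSRuns e H N R) {K : Finset (FullMerged σ)} (hK : P.IsLoop e K)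
    (h : ∀ (M : Structure σ) (a : ℕ → M.D), Truth M a (loopFormula K) → Truth M a H)
    (M : Structure σ) (a : ℕ → M.D) (ha : Truth M a (loopFormula K)) : Truth M a R := by
  induction hr with
  | returnFalse H h0 =>
    have := hK.subset_bfsNext h
    rw [h0] at this
    exact (hK.nonempty.ne_empty (Finset.subset_empty.1 this)).elim
  | returnLoop H _ _ => exact loopFormula_mono (hK.subset_bfsNext h) M a ha
  | iterate H _ _ N R _ ih => exact ih (loopFormula_mono (hK.subset_bfsNext h))

/-! ### Saturation -/

/-- The truth of the formulae of the universal and the initial part does not depend on the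
assignment. -/
structure HasSentences (P : Problem σ) : Prop where
  univ : ∀ φ ∈ P.univ, φ.IsSentence
  init : ∀ φ ∈ P.init, φ.IsSentence

open Classical in
/-- All potential conclusions of the resolution rules. -/
noncomputable def conclusions (P : Problem σ) : Finset (Formula σ) :=
  P.mergedDerived.image (fun C => .neg C.lhs) ∪
  P.eventualities.biUnion fun e => (P.candidates e).powerset.image (eventualityConclusion · e)

theorem Infers.mem_conclusions {adm : Problem σ → Eventuality σ → Finset (FullMerged σ) → Prop}
    {φ : Formula σ} (h : Infers adm P φ) : φ ∈ P.conclusions := by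
  classical
  unfold conclusions
  rw [Finset.mem_union, Finset.mem_image, Finset.mem_biUnion]
  cases h with
  | stepResolution C hC h => exact .inl ⟨C, hC, rfl⟩
  | eventualityResolution e he N hN h =>
    exact .inr ⟨e, he, Finset.mem_image.2 ⟨N, Finset.mem_powerset.2 hN.subset, rfl⟩⟩

theorem mem_mergeables {m : Mergeable σ} : m ∈ P.mergeables ↔
    (∃ s ∈ P.groundSteps, .ground s = m) ∨ (∃ s ⊆ P.steps, s.Nonempty ∧ .forallDisj s = m) ∨
    (∃ s ⊆ P.steps, s.Nonempty ∧ .existsConj s = m) ∨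
    ∃ s ∈ P.steps, ∃ c ∈ P.consts, .inst s c = m := by
  simp only [mergeables, Finset.mem_union, Finset.mem_image, Finset.mem_erase, ne_eq,
    Finset.mem_powerset, Finset.mem_product, Prod.exists, Finset.nonempty_iff_ne_empty]
  simp only [and_comm, and_assoc, or_assoc, and_left_comm, exists_and_left]

theorem mem_candidates_subset {e : Eventuality σ} {C : FullMerged σ} (h : C ∈ P.candidates e) :
    C.merged ⊆ P.mergeables ∧ C.side ⊆ P.steps := by
  cases e with
  | ground l =>
    simp only [candidates, mergedDerived, Finset.mem_image, Finset.mem_powerset] at h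
    obtain ⟨C, hC, rfl⟩ := h
    exact ⟨hC, by simp⟩
  | nonGround L =>
    simp only [candidates, fullMerged, mergedDerived, Finset.mem_image, Finset.mem_product,
      Finset.mem_powerset, Prod.exists] at h
    obtain ⟨C, s, hC, rfl⟩ := h
    exact hC

theorem consts_lhs_subset {C : MergedDerived σ} (h : C ⊆ P.mergeables) :
    C.lhs.consts ⊆ P.consts := by
  have hx : ∀ {n} (L : Lit σ n), (L.at x).consts ⊆ P.consts := fun L =>
    (L.consts_at x).trans (by simp [x, Tm.consts])
  refine consts_bigConj fun m hm => ?_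
  rcases mem_mergeables.1 (h hm) with ⟨s, -, rfl⟩ | ⟨s, -, -, rfl⟩ | ⟨s, -, -, rfl⟩ |
    ⟨s, -, c, hc, rfl⟩
  · exact hx _
  · exact consts_bigDisj fun t _ => hx _
  · exact consts_bigConj fun t _ => hx _
  · exact (s.lhs.consts_at _).trans (by simpa [Tm.consts] using hc)

theorem consts_of_mem_conclusions {φ : Formula σ} (h : φ ∈ P.conclusions) :
    φ.consts ⊆ P.consts := by
  classical
  simp only [conclusions, Finset.mem_union, Finset.mem_image, Finset.mem_biUnion,
    Finset.mem_powerset, mergedDerived] at h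
  rcases h with ⟨C, hC, rfl⟩ | ⟨e, -, N, hN, rfl⟩
  · exact consts_lhs_subset hC
  · cases e with
    | ground l => exact consts_bigConj fun C hC =>
        consts_lhs_subset (mem_candidates_subset (hN hC)).1
    | nonGround L =>
      refine consts_bigConj fun C hC => ?_
      exact Finset.union_subset (consts_lhs_subset (mem_candidates_subset (hN hC)).1)
        (consts_bigConj fun s _ => (s.lhs.consts_at x).trans (by simp [x, Tm.consts]))

theorem isSentence_of_mem_conclusions {φ : Formula σ} (h : φ ∈ P.conclusions) :
    φ.IsSentence := by
  simp only [conclusions, Finset.mem_union, Finset.mem_image, Finset.mem_biUnion,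
    Finset.mem_powerset, mergedDerived] at h
  rcases h with ⟨C, hC, rfl⟩ | ⟨e, -, N, hN, rfl⟩
  · intro M a b
    simp [Truth]
  · cases e <;> intro M a b <;> simp [Truth, eventualityConclusion]

open Classical in
theorem consts_insert {φ : Formula σ} (h : φ.consts ⊆ P.consts) :
    Problem.consts { P with univ := insert φ P.univ } = P.consts := by
  unfold consts at h ⊢
  simp only [Finset.insert_union, Finset.biUnion_insert]
  exact Finset.union_eq_right.2 h

-- Conclusions bring in no new constants, so the instances `L(c) ⇒ ○M(c)`, and with them all
-- candidate clauses, stay the same. Thus saturation draws on one fixed finite set.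
open Classical in
theorem conclusions_insert {φ : Formula σ} (h : φ.consts ⊆ P.consts) :
    Problem.conclusions { P with univ := insert φ P.univ } = P.conclusions := by
  have hm : Problem.mergeables { P with univ := insert φ P.univ } = P.mergeables := by
    unfold mergeables
    rw [consts_insert h]
  have hd : Problem.mergedDerived { P with univ := insert φ P.univ } = P.mergedDerived := by
    unfold mergedDerived
    rw [hm]
  have hc : ∀ e, Problem.candidates { P with univ := insert φ P.univ } e = P.candidates e := by
    intro e
    cases e <;> simp only [candidates, fullMerged, hd]
  unfold conclusions
  simp only [hd, hc]
  rfl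

open Classical in
theorem Refutable.of_infers {adm : Problem σ → Eventuality σ → Finset (FullMerged σ) → Prop}
    {φ : Formula σ} (h : Infers adm P φ)
    (hr : Refutable adm { P with univ := insert φ P.univ }) : Refutable adm P := by
  obtain ⟨n, U, h0, hU, ht⟩ := hr
  refine ⟨n + 1, fun k => Nat.casesOn k P.univ U, rfl, fun k hk => ?_, ht⟩
  cases k with
  | zero => exact ⟨φ, h, by simpa using h0⟩
  | succ k => exact hU k (by omega)

/-- A problem that cannot be refuted extends to a saturated one that cannot be refuted. -/
theorem exists_saturated {adm : Problem σ → Eventuality σ → Finset (FullMerged σ) → Prop}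
    (hP : P.HasSentences) (h : ¬ Refutable adm P) :
    ∃ U, P.univ ⊆ U ∧ HasSentences { P with univ := U } ∧ ¬ Terminates { P with univ := U } ∧
      ∀ φ, Infers adm { P with univ := U } φ → φ ∈ U := by
  classical
  induction hn : (P.conclusions \ P.univ).card using Nat.strong_induction_on generalizing P with
  | _ n ih =>
    by_cases hs : ∀ φ, Infers adm P φ → φ ∈ P.univ
    · exact ⟨P.univ, subset_rfl, hP, fun ht => h ⟨0, fun _ => P.univ, rfl, by simp, ht⟩, hs⟩
    push Not at hs
    obtain ⟨φ, hφ, hmem⟩ := hs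
    have hc := hφ.mem_conclusions
    -- The number of potential conclusions still missing from the universal part drops.
    obtain ⟨U, hU, hrest⟩ := ih _ (by
        rw [conclusions_insert (consts_of_mem_conclusions hc), ← hn]
        refine Finset.card_lt_card (Finset.ssubset_iff.2 ⟨φ, by simp, ?_⟩)
        intro ψ hψ
        simp only [Finset.mem_insert, Finset.mem_sdiff, not_or] at hψ ⊢
        rcases hψ with rfl | hψ
        · exact ⟨hc, hmem⟩
        · exact ⟨hψ.1, hψ.2.2⟩)
      (P := { P with univ := insert φ P.univ })
      ⟨by
        intro ψ hψ
        rcases Finset.mem_insert.1 hψ with rfl | hψ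
        · exact isSentence_of_mem_conclusions hc
        · exact hP.univ ψ hψ, hP.init⟩
      (fun hr => h (hr.of_infers hφ)) rfl
    exact ⟨U, (Finset.subset_insert _ _).trans hU, hrest⟩

end Problem

namespace Problem

/-! ### The behaviour graph -/

variable {P : Problem σ}

/-- The models of the universal part. -/
abbrev Node (P : Problem σ) : Type 1 := {M : Structure σ // ∀ φ ∈ P.univ, ∀ a, Truth M a φ}

/-- The models of the universal part with a distinguished element. -/
abbrev Point (P : Problem σ) : Type 1 := Σ M : P.Node, M.1.D

/-- `M'` is a possible successor of `M` as far as ground and derived step clauses are concerned. -/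
def NodeStep (P : Problem σ) (M M' : Structure σ) : Prop :=
  ∀ m ∈ P.mergeables, m.LhsHolds M → m.RhsHolds M'

/-- `d'` may develop from `d` as far as non-ground step clauses are concerned. -/
def ElementStep (P : Problem σ) (M M' : Structure σ) (d : M.D) (d' : M'.D) : Prop :=
  ∀ s ∈ P.steps, s.lhs.Holds M d → s.rhs.Holds M' d'

/-- The successor relation on models with a distinguished element. -/
def PointStep (P : Problem σ) (p q : P.Point) : Prop :=
  P.NodeStep p.1.1 q.1.1 ∧ P.ElementStep p.1.1 q.1.1 p.2 q.2

open Classical in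
/-- The merged derived step clause that fires in `M`. -/
noncomputable def firing (P : Problem σ) (M : Structure σ) : MergedDerived σ :=
  P.mergeables.filter fun m => m.LhsHolds M

open Classical in
/-- The non-ground step clauses that fire at `d`. -/
noncomputable def colour (P : Problem σ) (M : Structure σ) (d : M.D) : Finset (StepClause σ 1) :=
  P.steps.filter fun s => s.lhs.Holds M d

theorem mem_firing {M : Structure σ} {m : Mergeable σ} :
    m ∈ P.firing M ↔ m ∈ P.mergeables ∧ m.LhsHolds M := by
  simp [firing]

theorem mem_colour {M : Structure σ} {d : M.D} {s : StepClause σ 1} :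
    s ∈ P.colour M d ↔ s ∈ P.steps ∧ s.lhs.Holds M d := by
  simp [colour]

/-- The `∃`-derived clause for all clauses firing at `d` provides the successor; if none fires, any
element will do. -/
theorem NodeStep.exists_succ {M M' : Structure σ} (h : P.NodeStep M M') (d : M.D) :
    ∃ d', P.ElementStep M M' d d' := by
  rcases (P.colour M d).eq_empty_or_nonempty with h0 | hne
  · obtain ⟨d'⟩ := M'.nonempty
    refine ⟨d', fun s hs hl => ?_⟩
    have := mem_colour.2 ⟨hs, hl⟩
    simp [h0] at this
  · obtain ⟨d', hd'⟩ := h (.existsConj (P.colour M d))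
      (mem_mergeables.2 (.inr (.inr (.inl ⟨_, fun s hs => (mem_colour.1 hs).1, hne, rfl⟩))))
      ⟨d, fun s hs => (mem_colour.1 hs).2⟩
    exact ⟨d', fun s hs hl => hd' s (mem_colour.2 ⟨hs, hl⟩)⟩

/-- Otherwise each `d` has a firing clause whose right-hand side fails at `d'`. The `∀`-derived
clause of these clauses fires in `M`, so one of them holds at `d'` after all. -/
theorem NodeStep.exists_pred {M M' : Structure σ} (h : P.NodeStep M M') (d' : M'.D) :
    ∃ d, P.ElementStep M M' d d' := by
  classical
  by_contra hno
  simp only [ElementStep, not_exists, not_forall] at hno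
  choose s hs hl hr using hno
  obtain ⟨d₀⟩ := M.nonempty
  let F := P.steps.filter fun t => ∃ d, s d = t
  have hF : ∀ d, s d ∈ F := fun d => Finset.mem_filter.2 ⟨hs d, d, rfl⟩
  obtain ⟨t, ht, htr⟩ := h (.forallDisj F)
    (mem_mergeables.2 (.inr (.inl ⟨F, Finset.filter_subset _ _, ⟨_, hF d₀⟩, rfl⟩)))
    (fun d => ⟨s d, hF d, hl d⟩) d'
  obtain ⟨-, d, rfl⟩ := Finset.mem_filter.1 ht
  exact hr d htr

theorem NodeStep.const {M M' : Structure σ} (h : P.NodeStep M M') {c : σ.Const}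
    (hc : c ∈ P.consts) : P.ElementStep M M' (M.const c) (M'.const c) := fun s hs hl =>
  h (.inst s c) (mem_mergeables.2 (.inr (.inr (.inr ⟨s, hs, c, hc, rfl⟩)))) hl

/-- The clause that forces the development of a point. -/
noncomputable def clauseAt (P : Problem σ) (e : Eventuality σ) (p : P.Point) : FullMerged σ :=
  ⟨P.firing p.1.1, match e with
    | .ground _ => ∅
    | .nonGround _ => P.colour p.1.1 p.2⟩

theorem clauseAt_mem (e : Eventuality σ) (p : P.Point) : P.clauseAt e p ∈ P.candidates e := by
  classical
  have h : P.firing p.1.1 ∈ P.mergedDerived :=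
    Finset.mem_powerset.2 fun m hm => (mem_firing.1 hm).1
  cases e with
  | ground l => exact Finset.mem_image.2 ⟨_, h, rfl⟩
  | nonGround L =>
    refine Finset.mem_image.2 ⟨(P.firing p.1.1, P.colour p.1.1 p.2), ?_, rfl⟩
    exact Finset.mem_product.2 ⟨h, Finset.mem_powerset.2 fun s hs => (mem_colour.1 hs).1⟩

theorem truth_clauseAt_lhs (e : Eventuality σ) (p : P.Point) (a : ℕ → p.1.1.D) (ha : a 0 = p.2) :
    Truth p.1.1 a (P.clauseAt e p).lhs := by
  rw [FullMerged.truth_lhs, ha]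
  refine ⟨fun m hm => (mem_firing.1 hm).2, fun s hs => ?_⟩
  cases e with
  | ground l => simp [clauseAt] at hs
  | nonGround L => exact (mem_colour.1 hs).2

/-- For a ground eventuality the clause constrains no elements, so `a 0` need not continue `p`; some
other element does, and the truth of `e` does not depend on the choice. -/
theorem exists_pointStep_of_clauseAt_rhs {e : Eventuality σ} {p : P.Point} {M : P.Node}
    {a : ℕ → M.1.D} (h : Truth M.1 a (P.clauseAt e p).rhs) :
    ∃ d, P.PointStep p ⟨M, d⟩ ∧ (e.Holds M.1 (a 0) → e.Holds M.1 d) ∧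
      Truth M.1 a (P.clauseAt e ⟨M, d⟩).lhs := by
  rw [FullMerged.truth_rhs] at h
  have hstep : P.NodeStep p.1.1 M.1 := fun m hm hl => h.1 m (mem_firing.2 ⟨hm, hl⟩)
  cases e with
  | ground l =>
    obtain ⟨d, hd⟩ := hstep.exists_succ p.2
    refine ⟨d, ⟨hstep, hd⟩, (l.holds_ground _ _ _).1, ?_⟩
    rw [FullMerged.truth_lhs]
    exact ⟨fun m hm => (mem_firing.1 hm).2, fun s hs => by simp [clauseAt] at hs⟩
  | nonGround L =>
    exact ⟨a 0, ⟨hstep, fun s hs hl => h.2 s (mem_colour.2 ⟨hs, hl⟩)⟩, id,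
      truth_clauseAt_lhs (P := P) (.nonGround L) ⟨M, a 0⟩ a rfl⟩

theorem truth_of_isSentence (hP : P.HasSentences) {M : Structure σ} {a : ℕ → M.D}
    (h : ∀ φ ∈ P.univ, Truth M a φ) : ∀ φ ∈ P.univ, ∀ b, Truth M b φ :=
  fun φ hφ b => hP.univ φ hφ M a b (h φ hφ)

/-- If an eventuality is never satisfied after `p`, there is a loop in it that `p` satisfies. -/
theorem exists_isLoop (hP : P.HasSentences) (e : Eventuality σ) (p : P.Point)
    (h : ∀ q, Relation.TransGen P.PointStep p q → ¬ e.Holds q.1.1 q.2) :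
    ∃ K, P.IsLoop e K ∧ Truth p.1.1 (fun _ => p.2) (loopFormula K) := by
  classical
  -- The clauses of all points reachable from `p`, including `p`; a finite set even if there are
  -- infinitely many such points.
  let K := (P.candidates e).filter fun C =>
    ∃ q, Relation.ReflTransGen P.PointStep p q ∧ P.clauseAt e q = C
  have hK : ∀ q, Relation.ReflTransGen P.PointStep p q → P.clauseAt e q ∈ K := fun q hq =>
    Finset.mem_filter.2 ⟨clauseAt_mem e q, q, hq, rfl⟩
  -- A model of the universal part and of a right-hand side from `K` is itself reachable from `p`:
  -- the eventuality fails there, and its own clause is in `K`.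
  have key : ∀ C ∈ K, ∀ (M : Structure σ) (a : ℕ → M.D), Truth M a (.and P.univConj C.rhs) →
      ¬ e.Holds M (a 0) ∧ Truth M a (loopFormula K) := by
    rintro C hC M a ⟨hU, hr⟩
    obtain ⟨-, q, hq, rfl⟩ := Finset.mem_filter.1 hC
    obtain ⟨d, hd, he, hl⟩ := exists_pointStep_of_clauseAt_rhs
      (M := ⟨M, truth_of_isSentence hP ((truth_univConj M a).1 hU)⟩) hr
    exact ⟨fun hh => h _ (.tail' hq hd) (he hh),
      (truth_loopFormula _ _ _).2 ⟨_, hK _ (hq.tail hd), hl⟩⟩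
  refine ⟨K, ⟨Finset.filter_subset _ _, ⟨_, hK p .refl⟩, fun C hC => ?_, fun C hC => ?_⟩,
    (truth_loopFormula _ _ _).2 ⟨_, hK p .refl, truth_clauseAt_lhs e p _ rfl⟩⟩
  · rw [valid_all_imp]
    intro M a ha
    simpa [Truth] using (key C hC M a ha).1
  · rw [valid_all_imp]
    exact fun M a ha => (key C hC M a ha).2

theorem not_truth_loopFormula_of_conclusion {e : Eventuality σ} {N : Finset (FullMerged σ)}
    {M : Structure σ} {a : ℕ → M.D} (h : ∀ b, Truth M b (eventualityConclusion N e)) :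
    ¬ Truth M a (loopFormula N) := by
  rw [truth_loopFormula]
  rintro ⟨C, hC, hl⟩
  rw [FullMerged.truth_lhs] at hl
  have := h a
  cases e with
  | ground l =>
    simp only [eventualityConclusion, truth_bigConj, Truth, MergedDerived.truth_lhs] at this
    exact this C hC hl.1
  | nonGround L =>
    simp only [eventualityConclusion, Truth, truth_bigConj, MergedDerived.truth_lhs,
      FullMerged.truth_sideLhs] at this
    rcases this (a 0) C hC with h1 | h2
    · exact h1 hl.1
    · exact h2 (by simpa using hl.2)

/-- Saturation speaks only of loops found by the search; an arbitrary loop is covered because its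
formula implies the output. -/
theorem not_truth_loopFormula (hsat : ∀ φ, Infers FoundByBFS P φ → φ ∈ P.univ)
    {e : Eventuality σ} (he : e ∈ P.eventualities) {K : Finset (FullMerged σ)}
    (hK : P.IsLoop e K) (M : P.Node) (a : ℕ → M.1.D) : ¬ Truth M.1 a (loopFormula K) := by
  intro ha
  obtain ⟨N, R, hr⟩ := exists_bfsReturns P e
  have hR := BFSRuns.loopFormula_imp hr hK (fun _ _ _ => trivial) M.1 a ha
  rcases BFSRuns.eq_or_isLoop hr with ⟨-, rfl⟩ | ⟨hN, rfl⟩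
  · exact hR
  · exact not_truth_loopFormula_of_conclusion
      (M.2 _ (hsat _ (.eventualityResolution e he N hN ⟨hN.nonempty, hr⟩))) hR

/-- Without a successor, the right-hand side of the clause firing in `M` contradicts the universal
part, and step resolution adds the negation of a left-hand side that is true in `M`. -/
theorem exists_nodeStep {adm : Problem σ → Eventuality σ → Finset (FullMerged σ) → Prop}
    (hP : P.HasSentences) (hsat : ∀ φ, Infers adm P φ → φ ∈ P.univ) (M : P.Node) :
    ∃ M' : P.Node, P.NodeStep M.1 M'.1 := by
  classical
  by_contra hno
  obtain ⟨d⟩ := M.1.nonempty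
  have := M.2 _ (hsat _ (.stepResolution (P.firing M.1)
    (Finset.mem_powerset.2 fun m hm => (mem_firing.1 hm).1) ?_)) fun _ => d
  · exact this ((MergedDerived.truth_lhs _ _ _).2 fun m hm => (mem_firing.1 hm).2)
  · intro M' a h
    rw [Finset.forall_mem_insert] at h
    exact hno ⟨⟨M', truth_of_isSentence hP h.2⟩, fun m hm hl =>
      (MergedDerived.truth_rhs _ _ _).1 h.1 m (mem_firing.2 ⟨hm, hl⟩)⟩

/-- `r` assigns to each moment an element, in accordance with the non-ground step clauses, so that
all eventualities are satisfied infinitely often. -/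
def IsRun (P : Problem σ) (S : ℕ → Structure σ) (r : ∀ t, (S t).D) : Prop :=
  (∀ t, P.ElementStep (S t) (S (t + 1)) (r t) (r (t + 1))) ∧
    ∀ e ∈ P.eventualities, ∀ t, ∃ u, t ≤ u ∧ e.Holds (S u) (r u)

/-- A saturated problem to which no termination rule applies has a path of models of the universal
part, starting with a model of the initial part, such that every element lies on a run. -/
theorem exists_path_of_saturated (hP : P.HasSentences) (hterm : ¬ Terminates P)
    (hsat : ∀ φ, Infers FoundByBFS P φ → φ ∈ P.univ) :
    ∃ S : ℕ → Structure σ, (∀ φ ∈ P.init, ∀ a, Truth (S 0) a φ) ∧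
      (∀ t, ∀ φ ∈ P.univ, ∀ a, Truth (S t) a φ) ∧ (∀ t, P.NodeStep (S t) (S (t + 1))) ∧
      ∀ t d, ∃ r, r t = d ∧ P.IsRun S r := by
  classical
  -- The initial termination rule is the only one the construction relies on.
  have hinit : ∃ M : P.Node, ∀ φ ∈ P.init, ∀ a, Truth M.1 a φ := by
    by_contra hno
    refine hterm (.initial fun M a h => hno ?_)
    simp only [Finset.mem_union, or_imp, forall_and] at h
    exact ⟨⟨M, truth_of_isSentence hP h.1⟩, fun φ hφ b => hP.init φ hφ M a b (h.2 φ hφ)⟩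
  obtain ⟨M₀, hM₀⟩ := hinit
  obtain ⟨S, hS0, hS, hrun⟩ := exists_fair_path (E := P.Point) (π := Sigma.fst)
    (RN := fun M M' => P.NodeStep M.1 M'.1) (RE := P.PointStep)
    (T := {s // s ∈ P.steps.powerset}) (ι := {e // e ∈ P.eventualities})
    (τ := fun p => ⟨P.colour p.1.1 p.2, Finset.mem_powerset.2 fun s hs => (mem_colour.1 hs).1⟩)
    (L := fun e p => e.1.Holds p.1.1 p.2)
    (fun _ _ h => h.1) (exists_nodeStep hP hsat)
    (fun p M h => (h.exists_succ p.2).elim fun d hd => ⟨⟨M, d⟩, rfl, h, hd⟩)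
    (fun M p h => (h.exists_pred p.2).elim fun d hd => ⟨⟨M, d⟩, rfl, h, hd⟩)
    (by
      rintro ⟨M, d⟩ ⟨M', d'⟩ q rfl hc hpq
      refine ⟨hpq.1, fun s hs hl => hpq.2 s hs ?_⟩
      have := mem_colour.2 ⟨hs, hl⟩
      have hc : P.colour M.1 d = P.colour M.1 d' := congrArg Subtype.val hc
      exact (mem_colour.1 (hc.symm ▸ this : s ∈ P.colour M.1 d)).2)
    (by
      -- An eventuality never reached would yield a loop true at `p`, which saturation forbids.
      intro p e
      by_contra! hno
      obtain ⟨K, hK, ht⟩ := exists_isLoop hP e.1 p hno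
      exact not_truth_loopFormula hsat e.2 hK p.1 _ ht)
    M₀
  refine ⟨fun t => (S t).1, by subst hS0; exact hM₀, fun t => (S t).2, hS, fun t d => ?_⟩
  obtain ⟨r, hrt, hrS, hrR, hrL⟩ := hrun t ⟨S t, d⟩ rfl
  have : ∀ u, ∃ d : (S u).1.D, r u = ⟨S u, d⟩ := by
    intro u
    have := hrS u
    generalize r u = p at this
    obtain ⟨M, d⟩ := p
    subst this
    exact ⟨d, rfl⟩
  choose r' hr' using this
  obtain rfl : r = fun u => ⟨S u, r' u⟩ := funext hr'
  exact ⟨r', by simpa using hrt, fun u => (hrR u).2, fun e he u => hrL ⟨e, he⟩ u⟩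

end Problem

/-! ### From a path to a temporal model -/

theorem TFormula.truth_conj (M : TStructure σ) (t : ℕ) (a : ℕ → M.D) (l : List (TFormula σ)) :
    Truth M t a (conj l) ↔ ∀ φ ∈ l, Truth M t a φ := by
  induction l with
  | nil => simp [conj, Truth, Formula.Truth]
  | cons φ l ih =>
    simp only [conj, List.foldr_cons, Truth, List.forall_mem_cons] at ih ⊢
    rw [ih]

namespace Problem

variable {P : Problem σ}

theorem mem_eventualities_ground {l : Lit σ 0} : .ground l ∈ P.eventualities ↔ l ∈ P.groundEvs := by
  simp [eventualities]

theorem mem_eventualities_nonGround {L : Lit σ 1} :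
    .nonGround L ∈ P.eventualities ↔ L ∈ P.evs := by
  simp [eventualities]

/-- A sufficient semantic condition for satisfiability. -/
theorem satisfiable_of_truth (M : TStructure σ)
    (hinit : ∀ φ ∈ P.init, ∀ a, Truth (M.world 0) a φ)
    (huniv : ∀ t, ∀ φ ∈ P.univ, ∀ a, Truth (M.world t) a φ)
    (hground : ∀ t d, ∀ s ∈ P.groundSteps, s.lhs.Holds (M.world t) d →
      s.rhs.Holds (M.world (t + 1)) d)
    (hsteps : ∀ t d, ∀ s ∈ P.steps, s.lhs.Holds (M.world t) d → s.rhs.Holds (M.world (t + 1)) d)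
    (hevs : ∀ t d, ∀ e ∈ P.eventualities, ∃ u, t ≤ u ∧ e.Holds (M.world u) d) :
    P.Satisfiable := by
  obtain ⟨d₀⟩ := M.nonempty
  refine ⟨M, fun _ => d₀, ?_, ?_, ?_, ?_⟩
  · exact (truth_bigConj (M.world 0) _ _ _).2 fun φ hφ => hinit φ hφ _
  · intro t _
    exact (truth_univConj (M.world t) _).2 fun φ hφ => huniv t φ hφ _
  · intro t _ d
    rw [TFormula.truth_conj]
    intro φ hφ
    simp only [List.mem_append, List.mem_map, Finset.mem_toList] at hφ
    have key : ∀ {n} (s : StepClause σ n),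
        (s.lhs.Holds (M.world t) d → s.rhs.Holds (M.world (t + 1)) d) →
        TFormula.Truth M t (Function.update (fun _ => d₀) 0 d) s.formula := fun s h hl =>
      (s.rhs.truth_at (M.world (t + 1)) _ x).2 (h ((s.lhs.truth_at (M.world t) _ x).1 hl))
    rcases hφ with ⟨s, hs, rfl⟩ | ⟨s, hs, rfl⟩
    · exact key s (hground t d s hs)
    · exact key s (hsteps t d s hs)
  · intro t _ d
    rw [TFormula.truth_conj]
    intro φ hφ
    simp only [List.mem_map, Finset.mem_toList] at hφ
    obtain ⟨e, he, rfl⟩ := hφ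
    obtain ⟨u, hu, h⟩ := hevs t d e he
    exact ⟨u, hu, (e.truth_lit (M.world u) _).2 h⟩

/-! ### From the flooded problem back to the original one -/

theorem IsDSNF.hasSentences_flood (hP : P.IsDSNF) : P.flood.HasSentences where
  univ φ hφ := by
    classical
    simp only [flood, Finset.mem_union, Finset.mem_image] at hφ
    rcases hφ with ⟨ψ, hψ, rfl⟩ | ⟨⟨L, c⟩, -, rfl⟩
    · exact (hP.univ_closed ψ hψ).isSentence.flood
    · intro M a b
      simp only [Truth, Lit.truth_at, eval_const]
      rw [Lit.holds_ground]
      exact id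
  init φ hφ := by
    classical
    obtain ⟨ψ, hψ, rfl⟩ := Finset.mem_image.1 hφ
    exact (hP.init_closed ψ hψ).isSentence.flood

theorem consts_subset_flood {U : Finset (Formula σ.flood)} (hU : P.flood.univ ⊆ U) :
    P.consts ⊆ Problem.consts (σ := σ.flood) { P.flood with univ := U } := by
  classical
  intro c hc
  simp only [consts, Finset.mem_biUnion, Finset.mem_union] at hc ⊢
  obtain ⟨φ, hφ, hc⟩ := hc
  refine ⟨φ.flood, ?_, by rw [consts_flood]; exact hc⟩
  rcases hφ with hφ | hφ
  · exact .inl (hU (Finset.mem_union_left _ (Finset.mem_image_of_mem _ hφ)))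
  · exact .inr (Finset.mem_image_of_mem _ hφ)

/-- The domain consists of the runs, and predicates at moment `t` are read off the values at `t`;
step clauses and eventualities then hold by the definition of a run and of a node step. -/
theorem satisfiable_of_path {U : Finset (Formula σ.flood)} (hU : P.flood.univ ⊆ U)
    {S : ℕ → Structure σ.flood} (hinit : ∀ φ ∈ P.flood.init, ∀ a, Truth (S 0) a φ)
    (huniv : ∀ t, ∀ φ ∈ U, ∀ a, Truth (S t) a φ)
    (hstep : ∀ t, Problem.NodeStep { P.flood with univ := U } (S t) (S (t + 1)))
    (hrun : ∀ t d, ∃ r, r t = d ∧ Problem.IsRun { P.flood with univ := U } S r) :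
    P.Satisfiable := by
  classical
  set Q : Problem σ.flood := { P.flood with univ := U } with hQ
  let D := {r : ∀ t, (S t).D // Q.IsRun S r}
  obtain ⟨r₀, hr₀⟩ : ∃ r, Q.IsRun S r := by
    obtain ⟨d⟩ := (S 0).nonempty
    obtain ⟨r, -, hr⟩ := hrun 0 d
    exact ⟨r, hr⟩
  -- The flooded eventuality naming `L(c)` holds infinitely often along `r₀`; being a proposition,
  -- it does not depend on the element, and the clause `l ⇒ L(c)` passes this on to `c`.
  have hconst : ∀ c ∈ P.consts, Q.IsRun S fun t => (S t).const c := by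
    refine fun c hc => ⟨fun t => (hstep t).const (consts_subset_flood hU hc), fun e he t => ?_⟩
    cases e with
    | ground l =>
      obtain ⟨u, hu, h⟩ := hr₀.2 _ he t
      exact ⟨u, hu, (l.holds_ground _ _ _).1 h⟩
    | nonGround L =>
      obtain ⟨L, hL, rfl⟩ := Finset.mem_image.1 (mem_eventualities_nonGround.1 he)
      obtain ⟨u, hu, h⟩ := hr₀.2 (.ground (L.name c)) (mem_eventualities_ground.2
        (Finset.mem_union_right _ (Finset.mem_image.2
          ⟨(L, c), Finset.mem_product.2 ⟨hL, hc⟩, rfl⟩))) t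
      have := huniv u _ (hU (Finset.mem_union_right _ (Finset.mem_image.2
        ⟨(L, c), Finset.mem_product.2 ⟨hL, hc⟩, rfl⟩))) fun _ => r₀ u
      simp only [Truth, Lit.truth_at, eval_const] at this
      exact ⟨u, hu, this h⟩
  let M : TStructure σ :=
    { D := D
      nonempty := ⟨⟨r₀, hr₀⟩⟩
      -- Constants foreign to the problem denote an arbitrary run.
      const := fun c => if hc : c ∈ P.consts then ⟨_, hconst c hc⟩ else ⟨r₀, hr₀⟩
      pred := fun t _ p v => (S t).pred (FloodPred.old p) fun k => (v k).1 t }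
  -- Evaluation at `t` is onto because every element of `S t` lies on a run, so `truth_comp`
  -- applies.
  have htruth : ∀ t φ, φ.consts ⊆ P.consts → ∀ a : ℕ → D,
      Truth (M.world t) a φ ↔ Truth (S t) (fun i => (a i).1 t) φ.flood := by
    intro t φ hφ a
    rw [truth_flood]
    refine truth_comp (M := M.world t) (N := (S t).reduct) (h := fun r : D => r.1 t) ?_
      (fun _ _ => Iff.rfl) φ ?_ a
    · intro d
      obtain ⟨r, hr, hR⟩ := hrun t d
      exact ⟨⟨r, hR⟩, hr⟩
    · intro c hc
      simp only [TStructure.world, M]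
      rw [dif_pos (hφ hc)]
      rfl
  have hlit : ∀ {n} (L : Lit σ n) t (r : D), L.Holds (M.world t) r ↔ L.flood.Holds (S t) (r.1 t) :=
    fun L t r => Iff.rfl
  have hsub : ∀ φ ∈ P.univ ∪ P.init, φ.consts ⊆ P.consts := fun φ hφ =>
    Finset.subset_biUnion_of_mem Formula.consts hφ
  refine satisfiable_of_truth M (fun φ hφ a => ?_) (fun t φ hφ a => ?_) (fun t r s hs hl => ?_)
    (fun t r s hs hl => ?_) (fun t r e he => ?_)
  · refine (htruth 0 φ (hsub φ (Finset.mem_union_right _ hφ)) a).2 ?_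
    exact hinit _ (Finset.mem_image_of_mem _ hφ) _
  · refine (htruth t φ (hsub φ (Finset.mem_union_left _ hφ)) a).2 ?_
    exact huniv t _ (hU (Finset.mem_union_left _ (Finset.mem_image_of_mem _ hφ))) _
  · have := hstep t (.ground s.flood)
      (mem_mergeables.2 (.inl ⟨_, Finset.mem_image_of_mem _ hs, rfl⟩))
      ⟨_, (hlit s.lhs t r).1 hl⟩
    exact (hlit s.rhs (t + 1) r).2 ((Lit.holds_iff_exists _ _ _).2 this)
  · exact r.2.1 t s.flood (Finset.mem_image_of_mem _ hs) hl
  · cases e with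
    | ground l => exact r.2.2 (.ground l.flood) (mem_eventualities_ground.2
        (Finset.mem_union_left _ (Finset.mem_image_of_mem _ (mem_eventualities_ground.1 he)))) t
    | nonGround L => exact r.2.2 (.nonGround L.flood) (mem_eventualities_nonGround.2
        (Finset.mem_image_of_mem _ (mem_eventualities_nonGround.1 he))) t

theorem refutable_flood (hP : P.IsDSNF) (h : ¬ P.Satisfiable) : P.flood.Refutable FoundByBFS := by
  by_contra hr
  obtain ⟨U, hU, hs, hterm, hsat⟩ := exists_saturated hP.hasSentences_flood hr
  obtain ⟨S, h1, h2, h3, h4⟩ := exists_path_of_saturated hs hterm hsat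
  exact h (satisfiable_of_path hU h1 h2 h3 h4)

end Problem
end FOTL

/-- Relative completeness of temporal resolution. For every monodic temporal problem: breadth-first
loop search terminates on each eventuality; it either fails or its last set of clauses is a loop
whose loop formula is the output; every loop formula for the eventuality implies the output; and,
if the problem is unsatisfiable, its constant flooded form has a successfully terminating
derivation in which eventuality resolution is applied only to loops found by the search. -/
theorem mainTheorem10 (σ : FOTL.Signature) (P : FOTL.Problem σ) (hP : P.IsDSNF) :
    (∀ e ∈ P.eventualities,
      (∃ N H, P.BFSReturns e N H) ∧
      (∀ N H, P.BFSReturns e N H →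
        ((N = ∅ ∧ H = FOTL.Formula.fal) ∨
          (P.IsLoop e N ∧ H = FOTL.Problem.loopFormula N)) ∧
        (∀ K, P.IsLoop e K →
          (FOTL.Formula.all 0 (.imp (FOTL.Problem.loopFormula K) H)).Valid))) ∧
    (¬ P.Satisfiable → P.flood.Refutable FOTL.Problem.FoundByBFS) := by
  refine ⟨fun e _ => ⟨FOTL.Problem.exists_bfsReturns P e, fun N H hr =>
    ⟨FOTL.Problem.BFSRuns.eq_or_isLoop hr, fun K hK => ?_⟩⟩, FOTL.Problem.refutable_flood hP⟩
  rw [FOTL.Formula.valid_all_imp]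
  exact FOTL.Problem.BFSRuns.loopFormula_imp hr hK fun _ _ _ => trivial
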